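/- **Setting.** Let $\xi$ be a random sample with law $P$, let $f(\cdot;\xi):\mathbb R^n\to\mathbb R$ with $f(x;\cdot)$ integrable for every $x$, and consider $\phi^*=\inf_{x\in\mathbb R^n}\phi(x)$, $\phi=F+r$, $F(x)=\mathbb E_\xi[f(x;\xi)]$, where $r:\mathbb R^n\to\mathbb R\cup\{\infty\}$ is proper, closed and convex and $\phi^*>-\infty$. For a real function $h$, $\partial h(x)$ is the set of $v$ with $h(y)\ge h(x)+\langle v,y-x\rangle+o(\|y-x\|)$ as $y\to x$. Put $\operatorname{prox}_{\alpha r}(x)=\arg\min_y\{r(y)+\frac1{2\alpha}\|y-x\|^2\}$ and let $\phi_\lambda(x)=\inf_y\{\phi(y)+\frac1{2\lambda}\|y-x\|^2\}$ be the Moreau envelope. **Algorithm.** Choose a deterministic $x^{(0)}=x^{(1)}\in\operatorname{dom}(r)$ and, for $k=1,2,\dots$, let $$x^{(k+1)}=\operatorname{prox}_{\alpha_k r}\big(x^{(k)}-\alpha_k g^{(k)}+\beta_k(x^{(k)}-x^{(k-1)})\big),\qquad g^{(k)}=\tilde\nabla f(x^{(k-\tau_k)};\xi_k),$$ where $x^{(j)}:=x^{(1)}$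 for $j\le 0$, $\xi_k$ is a sample with law $P$ independent of $\tau_k$ and of all earlier samples and delays, $\tau_k$ is the delay, and $\tilde\nabla f(x;\xi)$ is a subgradient oracle (jointly measurable in $(x,\xi)$; the choice of subgradient may depend on $k$). **Assumptions.** 1. $F+\frac\rho2\|\cdot\|^2$ is convex, where $\rho>0$. 2. For every $x\in\operatorname{dom}(r)$, $\tilde\nabla f(x;\xi)\in\partial f(x;\xi)$ almost surely and $\mathbb E_\xi[\tilde\nabla f(x;\xi)]\in\partial F(x)$. 3. There is $M\ge0$ with $\mathbb E_\xi\|g(\xi)\|^2\le M^2$ for all $x\in\operatorname{dom}(r)$ and all measurable choices of subgradients $g(\xi)\in\partial f(x;\xi)$. 4. There are an integer $\tau\ge 0$ and $p_0,\dots,p_\tau$ with $\sum_{j=0}^\tau p_j=1$ such that $\mathbb P(\tau_k=j)=p_j$ for $0\le j\le\tau$ and all $k\ge1$, and $\tau_k$ is independent of the samples and delays of the earlier iterations. 5. At least one of the following holds: (i) there is $C_\phi$ with $|\phi(x)|\le C_\phi$ for all $x\in\operatorname{dom}(r)$; (ii) $r=r_1+r_2$, where $r_1$ is the indicator function of a closed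 convex set $X$, $r_2:\mathbb R^n\to\mathbb R$ is convex, and there is $M_r\ge0$ with $\|v\|\le M_r$ for all $x\in X$, $v\in\partial r_2(x)$. 6. $|F(x)|\le C_F$ for all $x\in\operatorname{dom}(r)$. **Parameters.** $\overline\rho\in(\rho,2\rho]$, $0<\alpha\le1/\overline\rho$, $0\le\tilde\beta<1-\frac{\alpha\rho}2$, $\beta\ge0$, and $\alpha_k=\alpha/\sqrt k$, $\beta_k=\min\{\tilde\beta,\beta/k^{1/4}\}$ for all $k\ge1$. **Claim.** Let $1\le k_0\le K$ be integers and let $T$ be drawn from $\{k_0,\dots,K\}$, independently of the samples and delays of the iterations $1,\dots,K-1$, with $\mathbb P(T=k)=\alpha_k/\sum_{j=k_0}^K\alpha_j$. Then $\phi_{1/\overline\rho}$ is differentiable, $\phi_{1/\overline\rho}(x^{(k_0)})$ and $\|\nabla\phi_{1/\overline\rho}(x^{(T)})\|^2$ are integrable, and $$\begin{aligned}\mathbb E\|\nabla\phi_{1/\overline\rho}(x^{(T)})\|^2\le\ &\tfrac{\overline\rho}{(\overline\rho-\rho)\alpha(\sqrt{K+1}-\sqrt{k_0})}\Big[\mathbb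 E\big[\phi_{1/\overline\rho}(x^{(k_0)})-\phi^*\big]+4\overline\rho M^2\alpha^2(1+\ln K-\ln k_0)\\&+\tfrac{\overline\rho}2\big(2\tilde\beta^2+\tfrac{2\beta^2}{\alpha(\overline\rho-\rho)}\big)\big(C_1+C_2\alpha^2(1+\ln K)\big)\\&+2\tfrac{\alpha}{\sqrt{k_0}}\overline\rho\tau C_F+\tfrac{\alpha}{\sqrt{k_0}}\tau^2\overline\rho\big(\tfrac\rho2+\tfrac{\rho^2}{\overline\rho-\rho}\big)\big(C_1+C_2\alpha^2(1+\ln K)\big)\\&+\alpha M\tau\overline\rho\sqrt{1+\ln K-\ln k_0}\,\sqrt{C_1+C_2\alpha^2(1+\ln K)}\Big],\end{aligned}$$ where $C_1=\frac{4\alpha C_\phi}{1-\frac{\alpha\rho}2-\tilde\beta}$, $C_2=\frac{4M^2}{(1-\frac{\alpha\rho}2-\tilde\beta)^2}$ if (i) holds, or $C_1=0$, $C_2=(M_r^2+M^2)\frac{4(1+\tilde\beta^2)}{(1-\tilde\beta^2)^2}$ if (ii) holds (if both hold, the bound holds with either pair). -/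

import Mathlib

open MeasureTheory ProbabilityTheory Topology

noncomputable section

namespace InertialSsGM

/-- The (Fréchet) subdifferential of `h` at `x`: all `v` with
`h y ≥ h x + ⟪v, y - x⟫ + o(‖y - x‖)` as `y → x`. -/
def subdifferential {n : ℕ} (h : EuclideanSpace ℝ (Fin n) → ℝ)
    (x : EuclideanSpace ℝ (Fin n)) : Set (EuclideanSpace ℝ (Fin n)) :=
  {v | ∀ ε : ℝ, 0 < ε → ∀ᶠ y in 𝓝 x, h x + inner ℝ v (y - x) - ε * ‖y - x‖ ≤ h y}

/-- `h` is `ρ`-weakly convex: `h + (ρ / 2) ‖·‖²` is convex. -/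
def WeaklyConvex {n : ℕ} (ρ : ℝ) (h : EuclideanSpace ℝ (Fin n) → ℝ) : Prop :=
  ConvexOn ℝ Set.univ fun x => h x + ρ / 2 * ‖x‖ ^ 2

/-- A proper closed (lower semicontinuous) convex function with values in `(-∞, ∞]`. -/
structure ProperClosedConvex {n : ℕ} (r : EuclideanSpace ℝ (Fin n) → EReal) : Prop where
  ne_bot : ∀ x, r x ≠ ⊥
  proper : ∃ x, r x ≠ ⊤
  closed : LowerSemicontinuous r
  convex : Convex ℝ {p : EuclideanSpace ℝ (Fin n) × ℝ | r p.1 ≤ (p.2 : EReal)}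

/-- The effective domain of a function with values in `(-∞, ∞]`. -/
def dom {n : ℕ} (r : EuclideanSpace ℝ (Fin n) → EReal) : Set (EuclideanSpace ℝ (Fin n)) :=
  {x | r x ≠ ⊤}

open Classical in
/-- The indicator function of `X` in the sense of convex analysis: `0` on `X`, `∞` off `X`. -/
def convexIndicator {n : ℕ} (X : Set (EuclideanSpace ℝ (Fin n)))
    (x : EuclideanSpace ℝ (Fin n)) : EReal :=
  if x ∈ X then 0 else ⊤

/-- The expected loss `F x = 𝔼_ξ [f (x; ξ)]`, where `ξ` has law `P`. -/
def expectedLoss {n : ℕ} {Ξ : Type*} [MeasurableSpace Ξ] (P : Measure Ξ)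
    (f : EuclideanSpace ℝ (Fin n) → Ξ → ℝ) (x : EuclideanSpace ℝ (Fin n)) : ℝ :=
  ∫ s, f x s ∂P

/-- The objective `φ = F + r`. -/
def objective {n : ℕ} (F : EuclideanSpace ℝ (Fin n) → ℝ)
    (r : EuclideanSpace ℝ (Fin n) → EReal) (x : EuclideanSpace ℝ (Fin n)) : EReal :=
  (F x : EReal) + r x

/-- The optimal value `φ* = inf φ`, as a real number. -/
def optimalValue {n : ℕ} (φ : EuclideanSpace ℝ (Fin n) → EReal) : ℝ :=
  (⨅ x, φ x).toReal

/-- The Moreau envelope `φ_lam (x) = inf_y { φ y + ‖y - x‖² / (2 lam) }`, as a real number. -/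
def moreauEnvelope {n : ℕ} (φ : EuclideanSpace ℝ (Fin n) → EReal) (lam : ℝ)
    (x : EuclideanSpace ℝ (Fin n)) : ℝ :=
  (⨅ y, φ y + ((1 / (2 * lam) * ‖y - x‖ ^ 2 : ℝ) : EReal)).toReal

/-- `z = prox_{a r} (x)`, i.e. `z` minimizes `y ↦ r y + ‖y - x‖² / (2 a)`. -/
def IsProx {n : ℕ} (r : EuclideanSpace ℝ (Fin n) → EReal) (a : ℝ)
    (x z : EuclideanSpace ℝ (Fin n)) : Prop :=
  ∀ y, r z + ((1 / (2 * a) * ‖z - x‖ ^ 2 : ℝ) : EReal)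
    ≤ r y + ((1 / (2 * a) * ‖y - x‖ ^ 2 : ℝ) : EReal)

/-- `G` is a stochastic subgradient oracle on `dom r`, possibly depending on the iteration `k ≥ 1`:
`G k x s` is a subgradient of `f (·; s)` at `x`, and its mean over the law `P` of the sample is a
subgradient of `F = 𝔼 f`. -/
structure IsUnbiasedOracle {n : ℕ} {Ξ : Type*} [MeasurableSpace Ξ] (P : Measure Ξ)
    (f : EuclideanSpace ℝ (Fin n) → Ξ → ℝ) (r : EuclideanSpace ℝ (Fin n) → EReal)
    (G : ℕ → EuclideanSpace ℝ (Fin n) → Ξ → EuclideanSpace ℝ (Fin n)) : Prop where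
  measurable : ∀ k, 1 ≤ k → Measurable (Function.uncurry (G k))
  mem_subdifferential : ∀ k, 1 ≤ k → ∀ x ∈ dom r,
    ∀ᵐ s ∂P, G k x s ∈ subdifferential (fun y => f y s) x
  unbiased : ∀ k, 1 ≤ k → ∀ x ∈ dom r,
    ∫ s, G k x s ∂P ∈ subdifferential (expectedLoss P f) x

/-- `𝔼 ‖g(ξ)‖² ≤ M²` for every `x ∈ dom r` and every (measurable) choice of subgradients
`g(ξ) ∈ ∂f (x; ξ)`. -/
def BoundedSubgradients {n : ℕ} {Ξ : Type*} [MeasurableSpace Ξ] (P : Measure Ξ)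
    (f : EuclideanSpace ℝ (Fin n) → Ξ → ℝ) (r : EuclideanSpace ℝ (Fin n) → EReal)
    (M : ℝ) : Prop :=
  ∀ x ∈ dom r, ∀ g : Ξ → EuclideanSpace ℝ (Fin n), Measurable g →
    (∀ᵐ s ∂P, g s ∈ subdifferential (fun y => f y s) x) →
    ∫⁻ s, ‖g s‖ₑ ^ 2 ∂P ≤ ENNReal.ofReal (M ^ 2)

/-- The samples and delays of the iterations `1, …, k - 1`. -/
def history {Ω Ξ : Type*} (ξ : ℕ → Ω → Ξ) (τ : ℕ → Ω → ℕ) (k : ℕ) (ω : Ω) :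
    (Set.Ico 1 k → Ξ) × (Set.Ico 1 k → ℕ) :=
  (fun j => ξ j ω, fun j => τ j ω)

/-- The samples `ξ_1, ξ_2, …` have law `P`, and `ξ_k` is independent of the earlier samples and of
the delays up to (and including) that of iteration `k`. -/
structure IsSampling {Ω Ξ : Type*} [MeasurableSpace Ω] [MeasurableSpace Ξ] (μ : Measure Ω)
    (P : Measure Ξ) (ξ : ℕ → Ω → Ξ) (τ : ℕ → Ω → ℕ) : Prop where
  measurable : ∀ k, 1 ≤ k → Measurable (ξ k)
  law : ∀ k, 1 ≤ k → μ.map (ξ k) = P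
  indep : ∀ k, 1 ≤ k → IndepFun (ξ k) (fun ω => (history ξ τ k ω, τ k ω)) μ

/-- The delays all follow the same distribution `(p_0, …, p_τmax)` on `{0, …, τmax}`, and `τ_k` is
independent of the samples and delays of the earlier iterations. -/
structure IsStochasticDelay {Ω Ξ : Type*} [MeasurableSpace Ω] [MeasurableSpace Ξ] (μ : Measure Ω)
    (ξ : ℕ → Ω → Ξ) (τ : ℕ → Ω → ℕ) (τmax : ℕ) (p : ℕ → ℝ) : Prop where
  measurable : ∀ k, 1 ≤ k → Measurable (τ k)
  sum_eq_one : ∑ j ∈ Finset.range (τmax + 1), p j = 1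
  law : ∀ k, 1 ≤ k → ∀ j ≤ τmax, μ.real {ω | τ k ω = j} = p j
  indep : ∀ k, 1 ≤ k → IndepFun (τ k) (history ξ τ k) μ

/-- `x` is the sequence of iterates of the distributed stochastic inertial proximal subgradient
method: `x⁽⁰⁾ = x⁽¹⁾ = x₀ ∈ dom r` and, for `k ≥ 1`,
`x⁽ᵏ⁺¹⁾ = prox_{a_k r} (x⁽ᵏ⁾ - a_k g⁽ᵏ⁾ + b_k (x⁽ᵏ⁾ - x⁽ᵏ⁻¹⁾))` with
`g⁽ᵏ⁾ = G_k (x⁽ᵏ⁻ᵗ⁾, ξ_k)`, `t = τ_k`. Natural subtraction implements the convention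
`x⁽ʲ⁾ = x⁽¹⁾` for `j ≤ 0`. -/
structure IsRun {n : ℕ} {Ω Ξ : Type*} (r : EuclideanSpace ℝ (Fin n) → EReal)
    (G : ℕ → EuclideanSpace ℝ (Fin n) → Ξ → EuclideanSpace ℝ (Fin n))
    (ξ : ℕ → Ω → Ξ) (τ : ℕ → Ω → ℕ) (a b : ℕ → ℝ) (x₀ : EuclideanSpace ℝ (Fin n))
    (x : ℕ → Ω → EuclideanSpace ℝ (Fin n)) : Prop where
  init_mem : x₀ ∈ dom r
  zero : ∀ ω, x 0 ω = x₀
  one : ∀ ω, x 1 ω = x₀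
  step : ∀ k, 1 ≤ k → ∀ ω,
    IsProx r (a k)
      (x k ω - a k • G k (x (k - τ k ω) ω) (ξ k ω) + b k • (x k ω - x (k - 1) ω))
      (x (k + 1) ω)

/-- The output index `T` is drawn from `{k₀, …, K}`, independently of the samples and delays that
determine `x⁽¹⁾, …, x⁽ᴷ⁾`, with `ℙ(T = k) = a_k / ∑_{j = k₀}^K a_j`. -/
structure IsOutputIndex {Ω Ξ : Type*} [MeasurableSpace Ω] [MeasurableSpace Ξ] (μ : Measure Ω)
    (ξ : ℕ → Ω → Ξ) (τ : ℕ → Ω → ℕ) (a : ℕ → ℝ) (k₀ K : ℕ) (T : Ω → ℕ) : Prop where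
  measurable : Measurable T
  law : ∀ k ∈ Finset.Icc k₀ K, μ.real {ω | T ω = k} = a k / ∑ j ∈ Finset.Icc k₀ K, a j
  indep : IndepFun T (history ξ τ K) μ

/-- `φ` is bounded by `Cφ` in absolute value on `dom r`. -/
def BoundedObjective {n : ℕ} (φ r : EuclideanSpace ℝ (Fin n) → EReal) (Cφ : ℝ) : Prop :=
  ∀ x ∈ dom r, |(φ x).toReal| ≤ Cφ

/-- `r` is the sum of the indicator function of a closed convex set `X` and of a convex function
`r₂` all of whose subgradients at points of `X` have norm at most `Mr`. -/
def IndicatorPlusBoundedSubgradients {n : ℕ} (r : EuclideanSpace ℝ (Fin n) → EReal)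
    (Mr : ℝ) : Prop :=
  ∃ (X : Set (EuclideanSpace ℝ (Fin n))) (r₂ : EuclideanSpace ℝ (Fin n) → ℝ),
    IsClosed X ∧ Convex ℝ X ∧ ConvexOn ℝ Set.univ r₂ ∧
    (∀ x, r x = convexIndicator X x + (r₂ x : EReal)) ∧
    ∀ x ∈ X, ∀ v ∈ subdifferential r₂ x, ‖v‖ ≤ Mr

end InertialSsGM

end

open InertialSsGM

namespace InertialSsGM

/-! ### Weakly convex functions along segments -/

section Convexity

variable {V : Type*} [NormedAddCommGroup V] [InnerProductSpace ℝ V]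

/-! The Moreau envelope `Φ` of parameter `1 / ρbar` serves as a Lyapunov function. If `z` is the
proximal point of `φ` at the iterate `x`, then `∇Φ(x) = ρbar (x - z)`, and testing the envelope at
the next iterate `y` with the same `z` gives `Φ(y) ≤ Φ(x) + ρbar / 2 (‖y - z‖² - ‖x - z‖²)`. So it
suffices to bound how far one step moves the iterate from `z`.

That bound is `IsProx.dist_prox_sq_le`: the variational inequality of the proximal step is added to
the optimality condition of `z` (`IsProx.first_order`), and the values of `r` cancel. Up to an
inertial cross term and second-order terms, what remains is a multiple of `F(x) - F(z) - ⟪x - z,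
g⟫`. In expectation `g` may be replaced by a subgradient of `F` at the delayed iterate
(`integral_inner_oracle`). Weak convexity there (`IsUnbiasedOracle.delayed_inner_ge`) cancels `F(x)
- F(z)` and leaves errors that depend only on `x⁽ᵏ⁾ - x⁽ᵏ⁻ʲ⁾` and on `F(x⁽ᵏ⁾) - F(x⁽ᵏ⁻ʲ⁾)`, averaged
over the delay law because `τ_k` is independent of the past. Since `ρ < ρbar ≤ 2ρ`, a negative
multiple of `a_k ‖x - z‖²` survives (`IsStochasticRun.expected_descent`).

The errors are then summed over `k` (`sum_descent_le`). The loss differences carry weights `a_k (1 -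
a_k ρbar)`, which first increase and then decrease, so summation by parts bounds their sum by a
multiple of `1 / √k₀`. The displacement errors are controlled by the total expected squared step
length. This total obeys a contractive recursion under either alternative: the objective is bounded,
or `r` is Lipschitz on its domain. Finally, the law of `T` turns the weighted sum of `E‖x - z‖²`
into the expected squared gradient norm, and `∑ a_k ≥ 2α(√(K+1) - √k₀)` gives the prefactor. -/

lemma nonneg_of_forall_add_mul_nonneg {p q : ℝ}
    (h : ∀ t : ℝ, 0 < t → t < 1 → 0 ≤ p + t * q) : 0 ≤ p := by
  have hc : Filter.Tendsto (fun t : ℝ => p + t * q) (𝓝[>] 0) (𝓝 (p + 0 * q)) :=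
    ((continuous_const.add (continuous_id.mul continuous_const)).tendsto 0).mono_left
      nhdsWithin_le_nhds
  have := ge_of_tendsto hc (b := 0) (by
    filter_upwards [Ioo_mem_nhdsGT (zero_lt_one (α := ℝ))] with t ht
    exact h t ht.1 ht.2)
  simpa using this

lemma norm_add_smul_sub_sq (x y : V) (t : ℝ) :
    ‖x + t • (y - x)‖ ^ 2 = (1 - t) * ‖x‖ ^ 2 + t * ‖y‖ ^ 2 - t * (1 - t) * ‖y - x‖ ^ 2 := by
  rw [norm_add_sq_real, norm_smul, mul_pow, norm_sub_sq_real, real_inner_smul_right,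
    inner_sub_right, real_inner_self_eq_norm_sq, real_inner_comm, Real.norm_eq_abs, sq_abs]
  ring

lemma ConvexOn.le_of_add_sq {D : Set V} {ψ : V → ℝ} {ρ : ℝ}
    (h : ConvexOn ℝ D fun x => ψ x + ρ / 2 * ‖x‖ ^ 2) {x y : V} (hx : x ∈ D) (hy : y ∈ D)
    {t : ℝ} (ht0 : 0 ≤ t) (ht1 : t ≤ 1) :
    ψ (x + t • (y - x)) ≤ (1 - t) * ψ x + t * ψ y + ρ / 2 * (t * (1 - t)) * ‖y - x‖ ^ 2 := by
  have h1 := h.2 hx hy (sub_nonneg.2 ht1) ht0 (by ring)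
  have h2 : (1 - t) • x + t • y = x + t • (y - x) := by module
  simp only [h2, smul_eq_mul, norm_add_smul_sub_sq] at h1
  linarith

lemma ConvexOn.add_smul_sub_mem {D : Set V} {ψ : V → ℝ} (h : ConvexOn ℝ D ψ) {x y : V}
    (hx : x ∈ D) (hy : y ∈ D) {t : ℝ} (ht0 : 0 ≤ t) (ht1 : t ≤ 1) : x + t • (y - x) ∈ D :=
  h.1.add_smul_sub_mem hx hy ⟨ht0, ht1⟩

/-- Quadratic growth at the minimizer of a weakly convex function plus a squared distance. -/
lemma quadratic_growth_of_isMin {D : Set V} {ψ : V → ℝ} {ρ c : ℝ}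
    (h : ConvexOn ℝ D fun x => ψ x + ρ / 2 * ‖x‖ ^ 2) {x z : V} (hz : z ∈ D)
    (hmin : ∀ y ∈ D, ψ z + c * ‖z - x‖ ^ 2 ≤ ψ y + c * ‖y - x‖ ^ 2) {y : V} (hy : y ∈ D) :
    ψ z + c * ‖z - x‖ ^ 2 + (c - ρ / 2) * ‖y - z‖ ^ 2 ≤ ψ y + c * ‖y - x‖ ^ 2 := by
  rw [← sub_nonneg]
  -- Minimality is tested at `z + t (y - z)`; after division by `t` the remainder is affine in `t`,
  -- and `t → 0` gives the claim.
  refine nonneg_of_forall_add_mul_nonneg (q := (c - ρ / 2) * ‖y - z‖ ^ 2) fun t ht0 ht1 => ?_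
  have h1 := hmin _ (h.add_smul_sub_mem hz hy ht0.le ht1.le)
  have h2 := h.le_of_add_sq hz hy ht0.le ht1.le
  have h3 := norm_add_smul_sub_sq (z - x) (y - x) t
  rw [sub_sub_sub_cancel_right, show z - x + t • (y - z) = z + t • (y - z) - x by abel] at h3
  rw [h3] at h1
  refine nonneg_of_mul_nonneg_right (a := t) ?_ ht0
  linarith

end Convexity

/-! ### Fréchet subgradients of weakly convex functions -/

section Subdifferential

variable {n : ℕ}

/-- Weak convexity makes the local first-order inequality global: it is applied at `x + t (y - x)`,
where `F` is bounded by its chord plus a quadratic. Dividing by `t`, then `t → 0` and `ε → 0`,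
removes both error terms. -/
lemma WeaklyConvex.le_of_mem_subdifferential {ρ : ℝ} {F : EuclideanSpace ℝ (Fin n) → ℝ}
    (hF : WeaklyConvex ρ F) {x v : EuclideanSpace ℝ (Fin n)} (hv : v ∈ subdifferential F x)
    (y : EuclideanSpace ℝ (Fin n)) :
    F x + inner ℝ v (y - x) - ρ / 2 * ‖y - x‖ ^ 2 ≤ F y := by
  rw [← sub_nonneg]
  refine nonneg_of_forall_add_mul_nonneg (q := ‖y - x‖) fun ε hε _ => ?_
  have hc : Filter.Tendsto (fun t : ℝ => x + t • (y - x)) (𝓝[>] 0) (𝓝 x) := by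
    have : Filter.Tendsto (fun t : ℝ => x + t • (y - x)) (𝓝 0) (𝓝 (x + (0 : ℝ) • (y - x))) :=
      Continuous.tendsto (by fun_prop) 0
    rw [zero_smul, add_zero] at this
    exact this.mono_left nhdsWithin_le_nhds
  have hev := (hc.eventually (hv ε hε)).and (Ioo_mem_nhdsGT (zero_lt_one (α := ℝ)))
  have hev2 : ∀ᶠ t : ℝ in 𝓝[>] 0, 0 ≤
      F y - (F x + inner ℝ v (y - x) - ρ / 2 * ‖y - x‖ ^ 2) + ε * ‖y - x‖
        - t * (ρ / 2 * ‖y - x‖ ^ 2) := by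
    filter_upwards [hev] with t ⟨h1, ht0, ht1⟩
    have h2 := ConvexOn.le_of_add_sq hF (Set.mem_univ x) (Set.mem_univ y) ht0.le ht1.le
    rw [add_sub_cancel_left, inner_smul_right, norm_smul, Real.norm_of_nonneg ht0.le] at h1
    refine nonneg_of_mul_nonneg_right (a := t) ?_ ht0
    linarith
  have hc2 : Filter.Tendsto (fun t : ℝ =>
      F y - (F x + inner ℝ v (y - x) - ρ / 2 * ‖y - x‖ ^ 2) + ε * ‖y - x‖
        - t * (ρ / 2 * ‖y - x‖ ^ 2)) (𝓝[>] 0) (𝓝 (F y - (F x + inner ℝ v (y - x)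
          - ρ / 2 * ‖y - x‖ ^ 2) + ε * ‖y - x‖ - 0 * (ρ / 2 * ‖y - x‖ ^ 2))) :=
    (Continuous.tendsto (by fun_prop) 0).mono_left nhdsWithin_le_nhds
  have := ge_of_tendsto hc2 hev2
  linarith

lemma WeaklyConvex.continuous {ρ : ℝ} {F : EuclideanSpace ℝ (Fin n) → ℝ}
    (hF : WeaklyConvex ρ F) : Continuous F := by
  have h : Continuous fun x => F x + ρ / 2 * ‖x‖ ^ 2 :=
    (ConvexOn.locallyLipschitz hF).continuous
  have h2 := h.sub (by fun_prop : Continuous fun x : EuclideanSpace ℝ (Fin n) => ρ / 2 * ‖x‖ ^ 2)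
  convert h2 using 1
  ext x
  simp

/-- A real-valued convex function has a subgradient everywhere. -/
lemma exists_mem_subdifferential {h : EuclideanSpace ℝ (Fin n) → ℝ}
    (hh : ConvexOn ℝ Set.univ h) (x : EuclideanSpace ℝ (Fin n)) :
    ∃ v ∈ subdifferential h x, ∀ y, h x + inner ℝ v (y - x) ≤ h y := by
  have hcont : Continuous h := hh.locallyLipschitz.continuous
  have hopen : IsOpen {p : EuclideanSpace ℝ (Fin n) × ℝ | p.1 ∈ Set.univ ∧ h p.1 < p.2} := by
    simp only [Set.mem_univ, true_and]
    exact isOpen_lt (hcont.comp continuous_fst) continuous_snd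
  -- A hyperplane separates the graph point from the open strict epigraph. Its vertical coefficient
  -- `c` is negative, so normalizing by `-c⁻¹` turns the horizontal part into a subgradient.
  obtain ⟨l, hl⟩ := geometric_hahn_banach_open_point hh.convex_strict_epigraph hopen
    (x := (x, h x)) (by simp)
  set c := l (0, 1) with hc
  have hlv : ∀ y s, l (y, s) = l (y, 0) + s * c := by
    intro y s
    have : ((y, s) : EuclideanSpace ℝ (Fin n) × ℝ) = (y, 0) + s • (0, 1) := by simp
    rw [this, map_add, map_smul, smul_eq_mul]
  have hcneg : c < 0 := by
    have := hl (x, h x + 1) (by simp)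
    rw [hlv x (h x + 1), hlv x (h x)] at this
    linarith
  have hle : ∀ y, l (y, 0) + h y * c ≤ l (x, 0) + h x * c := by
    intro y
    rw [← sub_nonneg]
    refine nonneg_of_forall_add_mul_nonneg (q := -c) fun t ht _ => ?_
    have := hl (y, h y + t) (by simpa using ht)
    rw [hlv, hlv x (h x)] at this
    linarith
  let l' : StrongDual ℝ (EuclideanSpace ℝ (Fin n)) :=
    (-c⁻¹) • l.comp (ContinuousLinearMap.inl ℝ _ _)
  have key : ∀ y, h x + inner ℝ ((InnerProductSpace.toDual ℝ _).symm l') (y - x) ≤ h y := by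
    intro y
    rw [InnerProductSpace.toDual_symm_apply]
    have h1 : l' (y - x) = (-c⁻¹) * (l (y, 0) - l (x, 0)) := by
      rw [← map_sub]
      simp [l']
    rw [h1]
    have h2 : (-c⁻¹) * (l (y, 0) - l (x, 0)) ≤ (-c⁻¹) * ((h x - h y) * c) :=
      mul_le_mul_of_nonneg_left (by linarith [hle y])
        (neg_nonneg.2 (inv_nonpos.2 hcneg.le))
    have h3 : (-c⁻¹) * ((h x - h y) * c) = h y - h x := by
      field_simp [hcneg.ne]
      ring
    linarith
  refine ⟨(InnerProductSpace.toDual ℝ _).symm l', fun ε hε => ?_, key⟩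
  filter_upwards with y
  have := mul_nonneg hε.le (norm_nonneg (y - x))
  linarith [key y]

end Subdifferential

/-! ### Existence, growth and Lipschitz continuity of proximal points -/

section ProximalMap

variable {n : ℕ}

namespace ProperClosedConvex

variable {r : EuclideanSpace ℝ (Fin n) → EReal}

lemma coe_toReal (hr : ProperClosedConvex r) {x : EuclideanSpace ℝ (Fin n)} (hx : x ∈ dom r) :
    ((r x).toReal : EReal) = r x :=
  EReal.coe_toReal hx (hr.ne_bot x)

lemma convexOn_toReal (hr : ProperClosedConvex r) :
    ConvexOn ℝ (dom r) fun x => (r x).toReal := by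
  have key : ∀ ⦃x⦄, x ∈ dom r → ∀ ⦃y⦄, y ∈ dom r → ∀ ⦃a b : ℝ⦄, 0 ≤ a → 0 ≤ b → a + b = 1 →
      r (a • x + b • y) ≤ ((a * (r x).toReal + b * (r y).toReal : ℝ) : EReal) := by
    intro x hx y hy a b ha hb hab
    have := hr.convex (x := (x, (r x).toReal)) (by simp [hr.coe_toReal hx])
      (y := (y, (r y).toReal)) (by simp [hr.coe_toReal hy]) ha hb hab
    simpa using this
  refine ⟨fun x hx y hy a b ha hb hab => ne_top_of_le_ne_top (EReal.coe_ne_top _)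
    (key hx hy ha hb hab), fun x hx y hy a b ha hb hab => ?_⟩
  have h1 := key hx hy ha hb hab
  have h2 : a • x + b • y ∈ dom r := ne_top_of_le_ne_top (EReal.coe_ne_top _) h1
  rw [← hr.coe_toReal h2, EReal.coe_le_coe_iff] at h1
  simpa using h1

lemma convex_dom (hr : ProperClosedConvex r) : Convex ℝ (dom r) := hr.convexOn_toReal.1

lemma objective_eq (hr : ProperClosedConvex r) (F : EuclideanSpace ℝ (Fin n) → ℝ)
    {x : EuclideanSpace ℝ (Fin n)} (hx : x ∈ dom r) :
    objective F r x = ((F x + (r x).toReal : ℝ) : EReal) := by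
  rw [objective, EReal.coe_add, hr.coe_toReal hx]

lemma toReal_objective (hr : ProperClosedConvex r) (F : EuclideanSpace ℝ (Fin n) → ℝ)
    {x : EuclideanSpace ℝ (Fin n)} (hx : x ∈ dom r) :
    (objective F r x).toReal = F x + (r x).toReal := by
  rw [hr.objective_eq F hx, EReal.toReal_coe]

lemma objective_eq_top (F : EuclideanSpace ℝ (Fin n) → ℝ)
    {x : EuclideanSpace ℝ (Fin n)} (hx : x ∉ dom r) : objective F r x = ⊤ := by
  have : r x = ⊤ := not_not.1 hx
  rw [objective, this, EReal.coe_add_top]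

lemma isProx_objective_iff (hr : ProperClosedConvex r) (F : EuclideanSpace ℝ (Fin n) → ℝ)
    {a : ℝ} {x z : EuclideanSpace ℝ (Fin n)} :
    IsProx (objective F r) a x z ↔ z ∈ dom r ∧ ∀ y ∈ dom r,
      F z + (r z).toReal + 1 / (2 * a) * ‖z - x‖ ^ 2
        ≤ F y + (r y).toReal + 1 / (2 * a) * ‖y - x‖ ^ 2 := by
  constructor
  · intro h
    obtain ⟨y₀, hy₀⟩ := hr.proper
    have hz : z ∈ dom r := by
      by_contra hz
      have := h y₀
      rw [objective_eq_top F hz, hr.objective_eq F hy₀, EReal.top_add_coe, ← EReal.coe_add] at this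
      exact EReal.coe_ne_top _ (top_le_iff.1 this)
    refine ⟨hz, fun y hy => ?_⟩
    have := h y
    rw [hr.objective_eq F hz, hr.objective_eq F hy] at this
    exact_mod_cast this
  · rintro ⟨hz, h⟩ y
    by_cases hy : y ∈ dom r
    · rw [hr.objective_eq F hz, hr.objective_eq F hy]
      exact_mod_cast h y hy
    · rw [objective_eq_top F hy, EReal.top_add_coe]
      exact le_top

lemma isProx_iff (hr : ProperClosedConvex r) {a : ℝ} {x z : EuclideanSpace ℝ (Fin n)} :
    IsProx r a x z ↔ z ∈ dom r ∧ ∀ y ∈ dom r,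
      (r z).toReal + 1 / (2 * a) * ‖z - x‖ ^ 2 ≤ (r y).toReal + 1 / (2 * a) * ‖y - x‖ ^ 2 := by
  have h := hr.isProx_objective_iff (fun _ => 0) (a := a) (x := x) (z := z)
  have h0 : objective (fun _ => 0) r = r := by
    ext x
    simp [objective]
  rw [h0] at h
  simpa using h

/-- Weierstrass on a closed ball. With `v` the value at a feasible point `y₀`, the radius `√((v - B)
/ c)` is such that outside the ball the quadratic term and the lower bound `B` alone already exceed
`v`. -/
lemma exists_isProx_objective (hr : ProperClosedConvex r) {F : EuclideanSpace ℝ (Fin n) → ℝ}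
    (hF : Continuous F) {B : ℝ} (hB : ∀ y ∈ dom r, B ≤ F y + (r y).toReal) {a : ℝ} (ha : 0 < a)
    (x : EuclideanSpace ℝ (Fin n)) : ∃ z, IsProx (objective F r) a x z := by
  obtain ⟨y₀, hy₀⟩ := hr.proper
  have hc : 0 < 1 / (2 * a) := by positivity
  set c := 1 / (2 * a) with hcdef
  set v := F y₀ + (r y₀).toReal + c * ‖y₀ - x‖ ^ 2 with hv
  have hvB : 0 ≤ v - B := by
    have := hB y₀ hy₀
    have : 0 ≤ c * ‖y₀ - x‖ ^ 2 := by positivity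
    linarith
  have hlsc : LowerSemicontinuous fun y =>
      ((F y + c * ‖y - x‖ ^ 2 : ℝ) : EReal) + r y := by
    -- Addition in `EReal` is continuous at these pairs because the first summand is finite.
    refine LowerSemicontinuous.add' ?_ hr.closed fun y =>
      EReal.continuousAt_add (Or.inl (EReal.coe_ne_top _)) (Or.inl (EReal.coe_ne_bot _))
    exact (continuous_coe_real_ereal.comp (by fun_prop)).lowerSemicontinuous
  have hmem : y₀ ∈ Metric.closedBall x √((v - B) / c) := by
    rw [mem_closedBall_iff_norm]
    refine Real.le_sqrt_of_sq_le ?_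
    rw [le_div_iff₀ hc]
    linarith [hB y₀ hy₀]
  obtain ⟨z, hz, hmin⟩ := (hlsc.lowerSemicontinuousOn _).exists_isMinOn ⟨y₀, hmem⟩
    (isCompact_closedBall x √((v - B) / c))
  have hzy₀ := hmin hmem
  simp only [Set.mem_ofPred_eq] at hzy₀
  have hzd : z ∈ dom r := by
    intro hz'
    rw [hz', ← hr.coe_toReal hy₀, EReal.coe_add_top, ← EReal.coe_add] at hzy₀
    exact EReal.coe_ne_top _ (top_le_iff.1 hzy₀)
  have hreal : ∀ y ∈ dom r, y ∈ Metric.closedBall x √((v - B) / c) →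
      F z + (r z).toReal + c * ‖z - x‖ ^ 2 ≤ F y + (r y).toReal + c * ‖y - x‖ ^ 2 := by
    intro y hy hyb
    have := hmin hyb
    simp only [Set.mem_ofPred_eq] at this
    rw [← hr.coe_toReal hy, ← hr.coe_toReal hzd, ← EReal.coe_add, ← EReal.coe_add,
      EReal.coe_le_coe_iff] at this
    linarith
  refine ⟨z, (hr.isProx_objective_iff F).2 ⟨hzd, fun y hy => ?_⟩⟩
  by_cases hyb : y ∈ Metric.closedBall x √((v - B) / c)
  · exact hreal y hy hyb
  · refine (hreal y₀ hy₀ hmem).trans ?_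
    rw [mem_closedBall_iff_norm, not_le, Real.sqrt_lt' (lt_of_le_of_ne (norm_nonneg _) ?_),
      div_lt_iff₀ hc] at hyb
    · linarith [hB y hy]
    · rintro h0
      rw [← h0] at hyb
      exact absurd hyb (not_lt.2 (Real.sqrt_nonneg _))

lemma exists_isProx (hr : ProperClosedConvex r) {B : ℝ} (hB : ∀ y ∈ dom r, B ≤ (r y).toReal)
    {a : ℝ} (ha : 0 < a) (x : EuclideanSpace ℝ (Fin n)) : ∃ z, IsProx r a x z := by
  obtain ⟨z, hz⟩ := hr.exists_isProx_objective (F := fun _ => 0) continuous_const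
    (B := B) (by simpa using hB) ha x
  refine ⟨z, hr.isProx_iff.2 ?_⟩
  simpa using (hr.isProx_objective_iff _).1 hz

lemma weaklyConvexOn (hr : ProperClosedConvex r) {ρ : ℝ} {F : EuclideanSpace ℝ (Fin n) → ℝ}
    (hF : WeaklyConvex ρ F) :
    ConvexOn ℝ (dom r) fun x => (F x + (r x).toReal) + ρ / 2 * ‖x‖ ^ 2 := by
  have h := (ConvexOn.subset hF (Set.subset_univ _) hr.convex_dom).add hr.convexOn_toReal
  refine h.congr fun x _ => ?_
  simp only [Pi.add_apply]
  ring

end ProperClosedConvex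

section Prox

variable {r : EuclideanSpace ℝ (Fin n) → EReal}

/-- Quadratic growth of the proximal subproblem of a weakly convex objective. -/
lemma IsProx.objective_growth (hr : ProperClosedConvex r) {ρ : ℝ}
    {F : EuclideanSpace ℝ (Fin n) → ℝ} (hF : WeaklyConvex ρ F) {a : ℝ}
    {x z y : EuclideanSpace ℝ (Fin n)} (h : IsProx (objective F r) a x z) (hy : y ∈ dom r) :
    F z + (r z).toReal + 1 / (2 * a) * ‖z - x‖ ^ 2 + (1 / (2 * a) - ρ / 2) * ‖y - z‖ ^ 2
      ≤ F y + (r y).toReal + 1 / (2 * a) * ‖y - x‖ ^ 2 := by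
  have h' := (hr.isProx_objective_iff F).1 h
  exact quadratic_growth_of_isMin (hr.weaklyConvexOn hF) h'.1 h'.2 hy

lemma IsProx.growth (hr : ProperClosedConvex r) {a : ℝ}
    {x z y : EuclideanSpace ℝ (Fin n)} (h : IsProx r a x z) (hy : y ∈ dom r) :
    (r z).toReal + 1 / (2 * a) * ‖z - x‖ ^ 2 + 1 / (2 * a) * ‖y - z‖ ^ 2
      ≤ (r y).toReal + 1 / (2 * a) * ‖y - x‖ ^ 2 := by
  have h' := hr.isProx_iff.1 h
  have := quadratic_growth_of_isMin (ρ := 0) (by simpa using hr.convexOn_toReal) h'.1 h'.2 hy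
  simpa using this

/-- The variational inequality of the proximal map. -/
lemma IsProx.inner_le (hr : ProperClosedConvex r) {a : ℝ} (ha : 0 < a)
    {x z y : EuclideanSpace ℝ (Fin n)} (h : IsProx r a x z) (hy : y ∈ dom r) :
    inner ℝ (x - z) (y - z) ≤ a * ((r y).toReal - (r z).toReal) := by
  have h1 := h.growth hr hy
  have h2 : ‖y - x‖ ^ 2 = ‖y - z‖ ^ 2 - 2 * inner ℝ (x - z) (y - z) + ‖z - x‖ ^ 2 := by
    rw [show y - x = (y - z) - (x - z) by abel, norm_sub_sq_real, real_inner_comm,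
      norm_sub_rev x z]
  rw [h2] at h1
  have h3 : 1 / (2 * a) * (2 * inner ℝ (x - z) (y - z)) ≤ (r y).toReal - (r z).toReal := by
    linarith
  have h4 : 1 / (2 * a) * (2 * inner ℝ (x - z) (y - z)) = inner ℝ (x - z) (y - z) / a := by
    field_simp
  rw [h4, div_le_iff₀ ha] at h3
  linarith

/-- Each proximal point is tested against the other one. Adding the two growth inequalities cancels
the function values and leaves `(1 - aρ) ‖z - z'‖² ≤ ⟪x - x', z - z'⟫`, to which Cauchy–Schwarz
applies. -/
lemma IsProx.objective_dist_le (hr : ProperClosedConvex r) {ρ : ℝ}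
    {F : EuclideanSpace ℝ (Fin n) → ℝ} (hF : WeaklyConvex ρ F) {a : ℝ} (ha : 0 < a)
    (haρ : a * ρ < 1) {x z x' z' : EuclideanSpace ℝ (Fin n)}
    (h : IsProx (objective F r) a x z) (h' : IsProx (objective F r) a x' z') :
    ‖z - z'‖ ≤ 1 / (1 - a * ρ) * ‖x - x'‖ := by
  have h1 := h.objective_growth hr hF ((hr.isProx_objective_iff F).1 h').1
  have h2 := h'.objective_growth hr hF ((hr.isProx_objective_iff F).1 h).1
  have h3 : ‖z' - x‖ ^ 2 + ‖z - x'‖ ^ 2 - ‖z - x‖ ^ 2 - ‖z' - x'‖ ^ 2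
      = 2 * inner ℝ (x - x') (z - z') := by
    simp only [norm_sub_sq_real, inner_sub_left, inner_sub_right, real_inner_comm]
    ring
  rw [norm_sub_rev z' z] at h1
  have h4 : (1 / a - ρ) * ‖z - z'‖ ^ 2 ≤ 1 / a * inner ℝ (x - x') (z - z') := by
    have e : 1 / (2 * a) = 1 / a / 2 := by rw [mul_comm, div_mul_eq_div_div]
    have e2 : 1 / a / 2 * (‖z' - x‖ ^ 2 + ‖z - x'‖ ^ 2 - ‖z - x‖ ^ 2 - ‖z' - x'‖ ^ 2) =
      1 / a / 2 * (2 * inner ℝ (x - x') (z - z')) := by rw [h3]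
    rw [e] at h1 h2
    linarith
  have h5 : (1 - a * ρ) * ‖z - z'‖ ^ 2 ≤ inner ℝ (x - x') (z - z') := by
    have := mul_le_mul_of_nonneg_left h4 ha.le
    field_simp at this
    linarith
  have h6 := real_inner_le_norm (x - x') (z - z')
  have h7 : 0 < 1 - a * ρ := by linarith
  rw [one_div, ← div_eq_inv_mul, le_div_iff₀ h7]
  rcases (norm_nonneg (z - z')).eq_or_lt with h0 | h0
  · rw [← h0, zero_mul]
    exact norm_nonneg _
  · refine le_of_mul_le_mul_right ?_ h0
    linarith

lemma IsProx.dist_le (hr : ProperClosedConvex r) {a : ℝ} (ha : 0 < a)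
    {x z x' z' : EuclideanSpace ℝ (Fin n)} (h : IsProx r a x z) (h' : IsProx r a x' z') :
    ‖z - z'‖ ≤ ‖x - x'‖ := by
  have h0 : objective (fun _ => 0) r = r := by
    ext x
    simp [objective]
  have h00 : WeaklyConvex 0 (fun _ : EuclideanSpace ℝ (Fin n) => (0 : ℝ)) := by
    simpa [WeaklyConvex] using convexOn_const (0 : ℝ) convex_univ
  rw [← h0] at h h'
  simpa using h.objective_dist_le hr h00 ha (by simp) h'

end Prox

end ProximalMap

/-! ### The Moreau envelope and the one-step distance estimate -/

section MoreauEnvelope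

variable {n : ℕ} {r : EuclideanSpace ℝ (Fin n) → EReal} {F : EuclideanSpace ℝ (Fin n) → ℝ}

lemma optimalValue_le (hr : ProperClosedConvex r) (hb : ⊥ < ⨅ x, objective F r x)
    {y : EuclideanSpace ℝ (Fin n)} (hy : y ∈ dom r) :
    optimalValue (objective F r) ≤ F y + (r y).toReal := by
  have h1 : (⨅ x, objective F r x) ≤ ((F y + (r y).toReal : ℝ) : EReal) :=
    (iInf_le _ y).trans (hr.objective_eq F hy).le
  have h2 := EReal.coe_toReal (ne_top_of_le_ne_top (EReal.coe_ne_top _) h1) hb.ne'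
  rw [← h2, EReal.coe_le_coe_iff] at h1
  exact h1

lemma moreauEnvelope_eq (hr : ProperClosedConvex r) {lam : ℝ} {x z : EuclideanSpace ℝ (Fin n)}
    (h : IsProx (objective F r) lam x z) :
    moreauEnvelope (objective F r) lam x = F z + (r z).toReal + 1 / (2 * lam) * ‖z - x‖ ^ 2 := by
  have h1 : (⨅ y, objective F r y + ((1 / (2 * lam) * ‖y - x‖ ^ 2 : ℝ) : EReal))
      = objective F r z + ((1 / (2 * lam) * ‖z - x‖ ^ 2 : ℝ) : EReal) :=
    le_antisymm (iInf_le _ z) (le_iInf h)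
  rw [moreauEnvelope, h1, hr.objective_eq F ((hr.isProx_objective_iff F).1 h).1, ← EReal.coe_add,
    EReal.toReal_coe]

lemma moreauEnvelope_le (hr : ProperClosedConvex r) {lam : ℝ} {x z : EuclideanSpace ℝ (Fin n)}
    (h : IsProx (objective F r) lam x z) {y : EuclideanSpace ℝ (Fin n)} (hy : y ∈ dom r) :
    moreauEnvelope (objective F r) lam x
      ≤ F y + (r y).toReal + 1 / (2 * lam) * ‖y - x‖ ^ 2 := by
  rw [moreauEnvelope_eq hr h]
  exact ((hr.isProx_objective_iff F).1 h).2 y hy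

/-- One-sided quadratic bound for the Moreau envelope. -/
lemma moreauEnvelope_le_add_inner (hr : ProperClosedConvex r) {lam : ℝ} (hlam : 0 < lam)
    {x z y w : EuclideanSpace ℝ (Fin n)} (h : IsProx (objective F r) lam x z)
    (hy : IsProx (objective F r) lam y w) :
    moreauEnvelope (objective F r) lam y ≤ moreauEnvelope (objective F r) lam x
      + inner ℝ (lam⁻¹ • (x - z)) (y - x) + 1 / (2 * lam) * ‖y - x‖ ^ 2 := by
  -- The proximal point of `x` is only a competitor in the envelope at `y`.
  have h1 := moreauEnvelope_le hr hy ((hr.isProx_objective_iff F).1 h).1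
  rw [moreauEnvelope_eq hr h]
  have h2 : ‖z - y‖ ^ 2 = ‖z - x‖ ^ 2 + 2 * inner ℝ (x - z) (y - x) + ‖y - x‖ ^ 2 := by
    rw [norm_sub_rev z y, show y - z = (x - z) + (y - x) by abel, norm_add_sq_real,
      norm_sub_rev x z]
  have h3 : 1 / (2 * lam) * (2 * inner ℝ (x - z) (y - x)) = lam⁻¹ * inner ℝ (x - z) (y - x) := by
    field_simp
  rw [h2] at h1
  rw [real_inner_smul_left, ← h3]
  linarith

/-- The Moreau envelope of a weakly convex objective is differentiable, with gradient
`(x - prox x) / lam`. -/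
lemma hasGradientAt_moreauEnvelope (hr : ProperClosedConvex r) {ρ : ℝ} (hF : WeaklyConvex ρ F)
    {lam : ℝ} (hlam : 0 < lam) (hlamρ : lam * ρ < 1)
    {Z : EuclideanSpace ℝ (Fin n) → EuclideanSpace ℝ (Fin n)}
    (hZ : ∀ x, IsProx (objective F r) lam x (Z x)) (x : EuclideanSpace ℝ (Fin n)) :
    HasGradientAt (moreauEnvelope (objective F r) lam) (lam⁻¹ • (x - Z x)) x := by
  set Φ := moreauEnvelope (objective F r) lam
  set L := 1 / (1 - lam * ρ)
  have hL : 0 ≤ L := one_div_nonneg.2 (by linarith)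
  set C := lam⁻¹ * (1 + L) + 1 / (2 * lam) with hC
  rw [hasGradientAt_iff_isLittleO]
  -- The one-sided quadratic bound is used from `x` to `y` and from `y` to `x`; Lipschitz continuity
  -- of `Z` compares the two linear terms, so the remainder is quadratic on both sides.
  have hbound : ∀ y, ‖Φ y - Φ x - inner ℝ (lam⁻¹ • (x - Z x)) (y - x)‖ ≤ C * ‖y - x‖ ^ 2 := by
    intro y
    have h1 := moreauEnvelope_le_add_inner hr hlam (hZ x) (hZ y)
    have h2 := moreauEnvelope_le_add_inner hr hlam (hZ y) (hZ x)
    change Φ y ≤ Φ x + _ + _ at h1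
    change Φ x ≤ Φ y + _ + _ at h2
    have h3 : inner ℝ (lam⁻¹ • (y - Z y)) (x - y) = - inner ℝ (lam⁻¹ • (x - Z x)) (y - x)
        - lam⁻¹ * inner ℝ ((y - x) - (Z y - Z x)) (y - x) := by
      simp only [real_inner_smul_left, inner_sub_left, inner_sub_right]
      ring
    have h4 : -inner ℝ ((y - x) - (Z y - Z x)) (y - x) ≤ (1 + L) * ‖y - x‖ ^ 2 := by
      refine (neg_le_abs _).trans ((abs_real_inner_le_norm _ _).trans ?_)
      have := (hZ y).objective_dist_le hr hF hlam hlamρ (hZ x)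
      have h5 : ‖(y - x) - (Z y - Z x)‖ ≤ (1 + L) * ‖y - x‖ := by
        refine (norm_sub_le _ _).trans ?_
        linarith
      calc _ ≤ (1 + L) * ‖y - x‖ * ‖y - x‖ := by gcongr
        _ = _ := by ring
    have h5 : lam⁻¹ * (-inner ℝ ((y - x) - (Z y - Z x)) (y - x))
        ≤ lam⁻¹ * ((1 + L) * ‖y - x‖ ^ 2) := mul_le_mul_of_nonneg_left h4 (by positivity)
    have h6 : 0 ≤ lam⁻¹ * ((1 + L) * ‖y - x‖ ^ 2) := by positivity
    rw [norm_sub_rev x y, h3] at h2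
    rw [Real.norm_eq_abs, abs_le, hC]
    constructor <;> linarith
  refine (Asymptotics.IsBigO.of_bound C (Filter.Eventually.of_forall fun y => ?_)).trans_isLittleO
    (Asymptotics.isLittleO_norm_pow_id one_lt_two |>.comp_tendsto (k := fun y => y - x) ?_)
  · simpa using hbound y
  · have : Filter.Tendsto (fun y => y - x) (𝓝 x) (𝓝 (x - x)) :=
      Continuous.tendsto (by fun_prop) x
    simpa using this

/-- First-order optimality of the proximal point `z` of `F + r`, stated without a subgradient of
`F` at `z`: a direction `u = y - z` is compared with the direction `(1 - s) • (x - z)`. -/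
lemma IsProx.first_order (hr : ProperClosedConvex r) {ρ M : ℝ} (hF : WeaklyConvex ρ F)
    (hLip : ∀ y ∈ dom r, ∀ y' ∈ dom r, F y - F y' ≤ M * ‖y - y'‖ + ρ / 2 * ‖y - y'‖ ^ 2)
    {ρbar a : ℝ} (ha0 : 0 ≤ a * ρbar) (ha1 : a * ρbar ≤ 1)
    {x z y : EuclideanSpace ℝ (Fin n)} (h : IsProx (objective F r) (1 / ρbar) x z)
    (hx : x ∈ dom r) (hy : y ∈ dom r) :
    0 ≤ (1 - a * ρbar) * (F x - F z + ρ / 2 * ‖x - z‖ ^ 2)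
      + M * ‖(y - z) - (1 - a * ρbar) • (x - z)‖ + (r y).toReal - (r z).toReal
      - ρbar * inner ℝ (x - z) (y - z) := by
  obtain ⟨hz, hmin⟩ := (hr.isProx_objective_iff F).1 h
  set c := 1 - a * ρbar with hc
  have hc0 : 0 ≤ c := by linarith
  have hc1 : c ≤ 1 := by linarith
  set w := ‖(y - z) - c • (x - z)‖ with hw
  have e : 1 / (2 * (1 / ρbar)) = ρbar / 2 := by
    rw [one_div, mul_inv, one_div, inv_inv]
    ring
  rw [e] at hmin
  -- Moving from `z` by `t (y - z)` is compared with moving by `t c (x - z)`, `c = 1 - a ρbar`. The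
  -- gap between the two points costs `M t w` plus a quadratic term through `hLip`, while `F` at the
  -- second point is bounded by convexity between `z` and `x`. `q` collects the terms of order `t²`,
  -- which vanish after division by `t`.
  refine nonneg_of_forall_add_mul_nonneg
    (q := ρ / 2 * w ^ 2 + ρbar / 2 * ‖y - z‖ ^ 2 - c ^ 2 * (ρ / 2 * ‖x - z‖ ^ 2))
    fun t ht0 ht1 => ?_
  have hyt := hr.convex_dom.add_smul_sub_mem hz hy ⟨ht0.le, ht1.le⟩
  have htc0 : 0 ≤ t * c := by positivity
  have htc1 : t * c ≤ 1 := by nlinarith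
  have hxt := hr.convex_dom.add_smul_sub_mem hz hx ⟨htc0, htc1⟩
  have h1 := hmin _ hyt
  have h2 := hr.convexOn_toReal.2 hz hy (sub_nonneg.2 ht1.le) ht0.le (by ring)
  rw [show (1 - t) • z + t • y = z + t • (y - z) by module] at h2
  simp only [smul_eq_mul] at h2
  have h3 := hLip _ hyt _ hxt
  rw [show z + t • (y - z) - (z + (t * c) • (x - z)) = t • ((y - z) - c • (x - z)) by module,
    norm_smul, Real.norm_of_nonneg ht0.le, ← hw] at h3
  have h4 := ConvexOn.le_of_add_sq hF (Set.mem_univ z) (Set.mem_univ x) htc0 htc1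
  have h5 : ‖z + t • (y - z) - x‖ ^ 2
      = ‖z - x‖ ^ 2 - 2 * t * inner ℝ (x - z) (y - z) + t ^ 2 * ‖y - z‖ ^ 2 := by
    rw [show z + t • (y - z) - x = t • (y - z) - (x - z) by abel, norm_sub_sq_real, norm_smul,
      real_inner_smul_left, mul_pow, Real.norm_eq_abs, sq_abs, norm_sub_rev x z,
      real_inner_comm]
    ring
  rw [h5] at h1
  refine nonneg_of_mul_nonneg_right (a := t) ?_ ht0
  linarith

/-- One proximal step compared with the proximal point `z` of the objective. -/
lemma IsProx.dist_prox_sq_le (hr : ProperClosedConvex r) {ρ M : ℝ} (hF : WeaklyConvex ρ F)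
    (hM : 0 ≤ M)
    (hLip : ∀ y ∈ dom r, ∀ y' ∈ dom r, F y - F y' ≤ M * ‖y - y'‖ + ρ / 2 * ‖y - y'‖ ^ 2)
    {ρbar a b : ℝ} (ha : 0 < a) (ha0 : 0 ≤ a * ρbar) (ha1 : a * ρbar ≤ 1)
    {x z y g d : EuclideanSpace ℝ (Fin n)} (h : IsProx (objective F r) (1 / ρbar) x z)
    (hx : x ∈ dom r) (hy : IsProx r a (x - a • g + b • d) y) :
    ‖y - z‖ ^ 2 ≤ (1 - a * ρbar) ^ 2 * ‖x - z‖ ^ 2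
      + 2 * (1 - a * ρbar) * b * inner ℝ (x - z) d
      - 2 * a * (1 - a * ρbar) * inner ℝ (x - z) g
      + 2 * a * (1 - a * ρbar) * (F x - F z + ρ / 2 * ‖x - z‖ ^ 2)
      + 2 * b ^ 2 * ‖d‖ ^ 2 + 4 * a ^ 2 * (‖g‖ ^ 2 + M ^ 2) := by
  have h1 := h.first_order hr hF hLip ha0 ha1 hx (hr.isProx_iff.1 hy).1
  have h2 := hy.inner_le hr ha ((hr.isProx_objective_iff F).1 h).1
  set c := 1 - a * ρbar with hc
  -- `A` is the expected value of `y - z` to leading order and `e` the deviation from it. Expanding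
  -- `‖y - z‖² = ‖A + e‖²` leaves `-‖e‖²`, which absorbs every term linear in `‖e‖`.
  set A := c • (x - z) with hA
  set e := (y - z) - A with he
  set m := b • d - a • g with hm
  have h3 := mul_le_mul_of_nonneg_left h1 ha.le
  have h4 : inner ℝ (x - a • g + b • d - y) (z - y)
      = ‖y - z‖ ^ 2 - inner ℝ (x - z) (y - z) - inner ℝ m (y - z) := by
    rw [show x - a • g + b • d - y = (x - z) + m - (y - z) by rw [hm]; abel,
      show z - y = -(y - z) by abel, inner_neg_right, inner_sub_left, inner_add_left,
      real_inner_self_eq_norm_sq]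
    ring
  have h5 : ‖y - z‖ ^ 2 = ‖A‖ ^ 2 + 2 * inner ℝ A e + ‖e‖ ^ 2 := by
    rw [show y - z = A + e by rw [he]; abel, norm_add_sq_real]
  have h6 : inner ℝ A (y - z) = ‖A‖ ^ 2 + inner ℝ A e := by
    rw [show y - z = A + e by rw [he]; abel, inner_add_right, real_inner_self_eq_norm_sq]
  have h6' : inner ℝ A (y - z) = c * inner ℝ (x - z) (y - z) := real_inner_smul_left _ _ _
  have h7 : inner ℝ m (y - z) = inner ℝ m A + inner ℝ m e := by
    rw [show y - z = A + e by rw [he]; abel, inner_add_right]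
  have h8 : inner ℝ m A = c * (b * inner ℝ (x - z) d - a * inner ℝ (x - z) g) := by
    rw [hm, hA, real_inner_smul_right, inner_sub_left, real_inner_smul_left,
      real_inner_smul_left, real_inner_comm, real_inner_comm g]
  have h9 := real_inner_le_norm m e
  -- Two applications of `(s + t)² ≤ 2s² + 2t²`: first inertia against gradient terms, then `‖g‖`
  -- against `M`.
  have h10 : (‖m‖ + a * M) ^ 2 ≤ 2 * b ^ 2 * ‖d‖ ^ 2 + 4 * a ^ 2 * (‖g‖ ^ 2 + M ^ 2) := by
    have h11 : ‖m‖ ≤ |b| * ‖d‖ + a * ‖g‖ := by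
      refine (norm_sub_le _ _).trans ?_
      rw [norm_smul, norm_smul, Real.norm_eq_abs, Real.norm_of_nonneg ha.le]
    have h12 : (‖m‖ + a * M) ^ 2 ≤ (|b| * ‖d‖ + a * (‖g‖ + M)) ^ 2 :=
      pow_le_pow_left₀ (by positivity) (by linarith) 2
    have h13 : (|b| * ‖d‖ + a * (‖g‖ + M)) ^ 2 ≤ 2 * (|b| * ‖d‖) ^ 2 + 2 * (a * (‖g‖ + M)) ^ 2 := by
      linarith [sq_nonneg (|b| * ‖d‖ - a * (‖g‖ + M))]
    have h14 : (a * (‖g‖ + M)) ^ 2 ≤ a ^ 2 * (2 * ‖g‖ ^ 2 + 2 * M ^ 2) := by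
      rw [mul_pow]
      gcongr
      linarith [sq_nonneg (‖g‖ - M)]
    rw [mul_pow, sq_abs] at h13
    linarith
  have h15 : 2 * (‖m‖ + a * M) * ‖e‖ - ‖e‖ ^ 2 ≤ (‖m‖ + a * M) ^ 2 := by
    linarith [sq_nonneg (‖m‖ + a * M - ‖e‖)]
  have h16 : ‖A‖ ^ 2 = c ^ 2 * ‖x - z‖ ^ 2 := by
    rw [hA, norm_smul, mul_pow, Real.norm_eq_abs, sq_abs]
  have h17 : c * inner ℝ (x - z) (y - z)
      = inner ℝ (x - z) (y - z) - a * ρbar * inner ℝ (x - z) (y - z) := by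
    rw [hc]
    ring
  rw [h4] at h2
  linarith

end MoreauEnvelope

/-! ### Bounds derived from the stochastic subgradient oracle -/

section Oracle

variable {n : ℕ} {Ξ : Type*} [MeasurableSpace Ξ] {P : Measure Ξ}
  {f : EuclideanSpace ℝ (Fin n) → Ξ → ℝ} {r : EuclideanSpace ℝ (Fin n) → EReal}
  {G : ℕ → EuclideanSpace ℝ (Fin n) → Ξ → EuclideanSpace ℝ (Fin n)} {M ρ : ℝ}

lemma IsUnbiasedOracle.lintegral_sq_le (hG : IsUnbiasedOracle P f r G)
    (hb : BoundedSubgradients P f r M) {k : ℕ} (hk : 1 ≤ k) {x : EuclideanSpace ℝ (Fin n)}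
    (hx : x ∈ dom r) : ∫⁻ s, ‖G k x s‖ₑ ^ 2 ∂P ≤ ENNReal.ofReal (M ^ 2) :=
  hb x hx (G k x) ((hG.measurable k hk).comp measurable_prodMk_left)
    (hG.mem_subdifferential k hk x hx)

lemma IsUnbiasedOracle.memLp (hG : IsUnbiasedOracle P f r G)
    (hb : BoundedSubgradients P f r M) {k : ℕ} (hk : 1 ≤ k) {x : EuclideanSpace ℝ (Fin n)}
    (hx : x ∈ dom r) : MemLp (G k x) 2 P := by
  refine ⟨((hG.measurable k hk).comp measurable_prodMk_left).aestronglyMeasurable, ?_⟩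
  rw [eLpNorm_lt_top_iff_lintegral_rpow_enorm_lt_top (by simp) (by simp)]
  have := (hG.lintegral_sq_le hb hk hx).trans_lt ENNReal.ofReal_lt_top
  simpa using this

lemma norm_integral_le_of_lintegral_sq_le [IsProbabilityMeasure P]
    {g : Ξ → EuclideanSpace ℝ (Fin n)} (hM : 0 ≤ M)
    (hg : AEStronglyMeasurable g P) (h : ∫⁻ s, ‖g s‖ₑ ^ 2 ∂P ≤ ENNReal.ofReal (M ^ 2)) :
    ‖∫ s, g s ∂P‖ ≤ M := by
  have h1 : eLpNorm g 1 P ≤ eLpNorm g 2 P :=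
    eLpNorm_le_eLpNorm_of_exponent_le one_le_two hg
  have h2 : eLpNorm g 2 P ≤ ENNReal.ofReal M := by
    rw [eLpNorm_eq_lintegral_rpow_enorm_toReal (by simp) (by simp)]
    have h3 := ENNReal.rpow_le_rpow h (by norm_num : (0 : ℝ) ≤ 1 / 2)
    rw [ENNReal.ofReal_rpow_of_nonneg (by positivity) (by norm_num), ← Real.sqrt_eq_rpow,
      Real.sqrt_sq hM] at h3
    simpa using h3
  have h4 : ‖∫ s, g s ∂P‖ₑ ≤ ENNReal.ofReal M := by
    refine (enorm_integral_le_lintegral_enorm g).trans ?_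
    rw [← eLpNorm_one_eq_lintegral_enorm]
    exact h1.trans h2
  rwa [← ofReal_norm, ENNReal.ofReal_le_ofReal_iff hM] at h4

lemma IsUnbiasedOracle.norm_mean_le [IsProbabilityMeasure P]
    (hG : IsUnbiasedOracle P f r G) (hM : 0 ≤ M)
    (hb : BoundedSubgradients P f r M) {k : ℕ} (hk : 1 ≤ k) {x : EuclideanSpace ℝ (Fin n)}
    (hx : x ∈ dom r) : ‖∫ s, G k x s ∂P‖ ≤ M :=
  norm_integral_le_of_lintegral_sq_le hM (hG.memLp hb hk hx).1 (hG.lintegral_sq_le hb hk hx)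

/-- The mean oracle is a subgradient of `F` of norm at most `M`, so its global inequality at `y`,
read at `y'`, makes `F` Lipschitz on `dom r` up to a quadratic. This is the `hLip` of the one-step
estimates. -/
lemma IsUnbiasedOracle.loss_sub_le [IsProbabilityMeasure P]
    (hG : IsUnbiasedOracle P f r G) (hM : 0 ≤ M)
    (hb : BoundedSubgradients P f r M) (hF : WeaklyConvex ρ (expectedLoss P f)) :
    ∀ y ∈ dom r, ∀ y' ∈ dom r, expectedLoss P f y - expectedLoss P f y'
      ≤ M * ‖y - y'‖ + ρ / 2 * ‖y - y'‖ ^ 2 := by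
  intro y hy y' _
  have h1 := hF.le_of_mem_subdifferential (hG.unbiased 1 le_rfl y hy) y'
  have h2 := hG.norm_mean_le hM hb le_rfl hy
  have h3 := neg_le_of_abs_le (abs_real_inner_le_norm (∫ s, G 1 y s ∂P) (y' - y))
  have h4 := mul_le_mul_of_nonneg_right h2 (norm_nonneg (y' - y))
  rw [norm_sub_rev y y']
  linarith

/-- Lower bound of the inner product with a delayed mean subgradient. -/
lemma IsUnbiasedOracle.delayed_inner_ge [IsProbabilityMeasure P]
    (hG : IsUnbiasedOracle P f r G) (hM : 0 ≤ M)
    (hb : BoundedSubgradients P f r M) (hF : WeaklyConvex ρ (expectedLoss P f)) (hρ : 0 < ρ)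
    {ρbar : ℝ} (hρbar : ρ < ρbar) {k : ℕ} (hk : 1 ≤ k) {x y : EuclideanSpace ℝ (Fin n)}
    (hy : y ∈ dom r) (z : EuclideanSpace ℝ (Fin n)) :
    - M * ‖x - y‖ + expectedLoss P f y - expectedLoss P f z
        - (ρ / 2 + (ρbar - ρ) / 4) * ‖x - z‖ ^ 2
        - (ρ / 2 + ρ ^ 2 / (ρbar - ρ)) * ‖x - y‖ ^ 2
      ≤ inner ℝ (x - z) (∫ s, G k y s ∂P) := by
  set w := ∫ s, G k y s ∂P with hw
  have h1 := hF.le_of_mem_subdifferential (hG.unbiased k hk y hy) z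
  have h2 := hG.norm_mean_le hM hb hk hy
  rw [← hw] at h1 h2
  -- `w` is a subgradient at the delayed point `y`, so weak convexity controls the displacement `z -
  -- y`; the rest, `x - y`, is paid for with `‖w‖ ≤ M`.
  have h3 : inner ℝ (x - z) w = inner ℝ (x - y) w - inner ℝ w (z - y) := by
    rw [show x - z = (x - y) - (z - y) by abel, inner_sub_left, real_inner_comm w (x - y),
      real_inner_comm w (z - y)]
  have h4 := neg_le_of_abs_le (abs_real_inner_le_norm (x - y) w)
  have h5 := mul_le_mul_of_nonneg_left h2 (norm_nonneg (x - y))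
  have h6 : ‖z - y‖ ^ 2 ≤ ‖x - z‖ ^ 2 + ‖x - y‖ ^ 2 + 2 * (‖x - z‖ * ‖x - y‖) := by
    rw [show z - y = (x - y) - (x - z) by abel, norm_sub_sq_real]
    linarith [neg_le_of_abs_le (abs_real_inner_le_norm (x - y) (x - z)),
      mul_comm ‖x - z‖ ‖x - y‖]
  have hpos : 0 < ρbar - ρ := sub_pos.2 hρbar
  -- The Young weight on `‖x - z‖²` is a quarter of `ρbar - ρ`, small enough to be absorbed by the
  -- decrease of the envelope.
  have h7 : ρ * (‖x - z‖ * ‖x - y‖)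
      ≤ (ρbar - ρ) / 4 * ‖x - z‖ ^ 2 + ρ ^ 2 / (ρbar - ρ) * ‖x - y‖ ^ 2 := by
    have : (ρbar - ρ) / 4 * ‖x - z‖ ^ 2 + ρ ^ 2 / (ρbar - ρ) * ‖x - y‖ ^ 2
        - ρ * (‖x - z‖ * ‖x - y‖)
        = ((ρbar - ρ) / 2 * ‖x - z‖ - ρ * ‖x - y‖) ^ 2 / (ρbar - ρ) := by
      field_simp
      ring
    have h8 : 0 ≤ ((ρbar - ρ) / 2 * ‖x - z‖ - ρ * ‖x - y‖) ^ 2 / (ρbar - ρ) := by positivity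
    linarith
  have h9 := mul_le_mul_of_nonneg_left h6 (by positivity : 0 ≤ ρ / 2)
  linarith

end Oracle

/-! ### Length of a single step -/

section StepLength

variable {n : ℕ} {r : EuclideanSpace ℝ (Fin n) → EReal}

/-- Length of a step in terms of the decrease of the objective. -/
lemma IsProx.step_sq_le_of_objective (hr : ProperClosedConvex r)
    {F : EuclideanSpace ℝ (Fin n) → ℝ} {ρ M α a b βt : ℝ} (hρ : 0 < ρ)
    (hLip : ∀ y ∈ dom r, ∀ y' ∈ dom r, F y - F y' ≤ M * ‖y - y'‖ + ρ / 2 * ‖y - y'‖ ^ 2)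
    (ha : 0 < a) (haα : a ≤ α) (hb : 0 ≤ b) (hbβ : b ≤ βt) (hc : 0 < 1 - α * ρ / 2 - βt)
    {x y g d : EuclideanSpace ℝ (Fin n)} (hx : x ∈ dom r)
    (hy : IsProx r a (x - a • g + b • d) y) :
    (1 - α * ρ / 2) / 2 * ‖y - x‖ ^ 2 ≤ βt / 2 * ‖d‖ ^ 2
      + a ^ 2 * (‖g‖ ^ 2 + M ^ 2) / (1 - α * ρ / 2 - βt)
      + a * ((F x + (r x).toReal) - (F y + (r y).toReal)) := by
  have h1 := hy.inner_le hr ha hx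
  have h2 := hLip y (hr.isProx_iff.1 hy).1 x hx
  set c := 1 - α * ρ / 2 - βt with hcd
  have h3 : inner ℝ (x - a • g + b • d - y) (x - y)
      = ‖y - x‖ ^ 2 - b * inner ℝ d (y - x) + a * inner ℝ g (y - x) := by
    rw [show x - a • g + b • d - y = b • d - a • g - (y - x) by abel,
      show x - y = -(y - x) by abel, inner_neg_right, inner_sub_left, inner_sub_left,
      real_inner_self_eq_norm_sq, real_inner_smul_left, real_inner_smul_left]
    ring
  rw [h3] at h1
  have h4 : b * inner ℝ d (y - x) ≤ βt / 2 * ‖d‖ ^ 2 + βt / 2 * ‖y - x‖ ^ 2 := by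
    have h5 : b * inner ℝ d (y - x) ≤ βt * (‖d‖ * ‖y - x‖) :=
      
      (mul_le_mul_of_nonneg_left (real_inner_le_norm _ _) hb).trans
        (mul_le_mul_of_nonneg_right hbβ (by positivity))
    have h6 := mul_nonneg (hb.trans hbβ) (sq_nonneg (‖d‖ - ‖y - x‖))
    linarith
  have h7 : -(a * inner ℝ g (y - x)) ≤ a * (‖g‖ * ‖y - x‖) := by
    rw [← mul_neg]
    exact mul_le_mul_of_nonneg_left ((neg_le_abs _).trans (abs_real_inner_le_norm _ _)) ha.le
  have h8 := mul_le_mul_of_nonneg_left h2 ha.le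
  have h9 : a * (ρ / 2 * ‖y - x‖ ^ 2) ≤ α * (ρ / 2 * ‖y - x‖ ^ 2) :=
    mul_le_mul_of_nonneg_right haα (by positivity)
  -- Half of `c` is spent here; the coefficients left on `‖y - x‖²` and `‖d‖²` then differ by `c /
  -- 2`, which makes the recursion contractive.
  have h10 : a * ((‖g‖ + M) * ‖y - x‖) ≤ c / 2 * ‖y - x‖ ^ 2 + a ^ 2 * (‖g‖ ^ 2 + M ^ 2) / c := by
    have h11 : c / 2 * ‖y - x‖ ^ 2 + a ^ 2 * (‖g‖ ^ 2 + M ^ 2) / c - a * ((‖g‖ + M) * ‖y - x‖)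
        = ((c * ‖y - x‖ - a * (‖g‖ + M)) ^ 2 + a ^ 2 * (‖g‖ - M) ^ 2) / (2 * c) := by
      field_simp
      ring
    have h12 : 0 ≤ ((c * ‖y - x‖ - a * (‖g‖ + M)) ^ 2 + a ^ 2 * (‖g‖ - M) ^ 2) / (2 * c) := by
      positivity
    linarith
  have h13 : (1 - α * ρ / 2) / 2 * ‖y - x‖ ^ 2 = ‖y - x‖ ^ 2 - βt / 2 * ‖y - x‖ ^ 2
      - c / 2 * ‖y - x‖ ^ 2 - α * (ρ / 2 * ‖y - x‖ ^ 2) := by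
    rw [hcd]
    ring
  rw [h13]
  linarith

/-- On its domain `r` equals the finite convex function `r₂`, whose subgradient inequality at `x`
gives a Lipschitz bound with constant `Mr`. -/
lemma IndicatorPlusBoundedSubgradients.toReal_sub_le {Mr : ℝ}
    (h : IndicatorPlusBoundedSubgradients r Mr) {x y : EuclideanSpace ℝ (Fin n)}
    (hx : x ∈ dom r) (hy : y ∈ dom r) :
    (r x).toReal - (r y).toReal ≤ Mr * ‖y - x‖ := by
  obtain ⟨X, r₂, _, _, hconv, hr, hbd⟩ := h
  have hmem : ∀ {x}, x ∈ dom r → x ∈ X ∧ (r x).toReal = r₂ x := by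
    intro x hx
    have hxX : x ∈ X := by
      by_contra hxX
      refine hx ?_
      rw [hr x, convexIndicator, if_neg hxX, EReal.top_add_coe]
    refine ⟨hxX, ?_⟩
    rw [hr x, convexIndicator, if_pos hxX, zero_add, EReal.toReal_coe]
  obtain ⟨v, hv, hv'⟩ := exists_mem_subdifferential hconv x
  rw [(hmem hx).2, (hmem hy).2]
  have h1 := hv' y
  have h2 := neg_le_of_abs_le (abs_real_inner_le_norm v (y - x))
  have h3 := mul_le_mul_of_nonneg_right (hbd x (hmem hx).1 v hv) (norm_nonneg (y - x))
  linarith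

/-- Length of a step when the regularizer is Lipschitz on its domain. -/
lemma IsProx.step_sq_le_of_lipschitz (hr : ProperClosedConvex r) {Mr a b βt : ℝ}
    (hMr : 0 ≤ Mr) (hLip : ∀ x ∈ dom r, ∀ y ∈ dom r, (r x).toReal - (r y).toReal ≤ Mr * ‖y - x‖)
    (ha : 0 < a) (hb : 0 ≤ b) (hbβ : b ≤ βt) (hβ1 : βt < 1)
    {x y g d : EuclideanSpace ℝ (Fin n)} (hx : x ∈ dom r)
    (hy : IsProx r a (x - a • g + b • d) y) :
    ‖y - x‖ ^ 2 ≤ (1 + βt ^ 2) / 2 * ‖d‖ ^ 2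
      + 2 * (1 + βt ^ 2) / (1 - βt ^ 2) * (a ^ 2 * (‖g‖ ^ 2 + Mr ^ 2)) := by
  have h1 := hy.inner_le hr ha hx
  have h2 := mul_le_mul_of_nonneg_left (hLip x hx y (hr.isProx_iff.1 hy).1) ha.le
  have h3 : inner ℝ (x - a • g + b • d - y) (x - y)
      = ‖y - x‖ ^ 2 - b * inner ℝ d (y - x) + a * inner ℝ g (y - x) := by
    rw [show x - a • g + b • d - y = b • d - a • g - (y - x) by abel,
      show x - y = -(y - x) by abel, inner_neg_right, inner_sub_left, inner_sub_left,
      real_inner_self_eq_norm_sq, real_inner_smul_left, real_inner_smul_left]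
    ring
  rw [h3] at h1
  have h5 : b * inner ℝ d (y - x) ≤ βt * (‖d‖ * ‖y - x‖) :=
    
      (mul_le_mul_of_nonneg_left (real_inner_le_norm _ _) hb).trans
        (mul_le_mul_of_nonneg_right hbβ (by positivity))
  have h7 : -(a * inner ℝ g (y - x)) ≤ a * (‖g‖ * ‖y - x‖) := by
    rw [← mul_neg]
    exact mul_le_mul_of_nonneg_left ((neg_le_abs _).trans (abs_real_inner_le_norm _ _)) ha.le
  have hβ0 := hb.trans hbβ
  set q := a * (‖g‖ + Mr) with hq
  have hq0 : 0 ≤ q := by positivity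
  have h8 : ‖y - x‖ ≤ βt * ‖d‖ + q := by
    rcases (norm_nonneg (y - x)).eq_or_lt with h0 | h0
    · rw [← h0]
      positivity
    · refine le_of_mul_le_mul_right ?_ h0
      rw [hq]
      linarith
  have h9 := pow_le_pow_left₀ (norm_nonneg _) h8 2
  have hB : 0 < 1 - βt ^ 2 := by nlinarith
  -- The Young weight is chosen so that `‖d‖²` gets the coefficient `(1 + βt²) / 2`, midway between
  -- `βt²` and `1`, hence still contractive.
  have h10 : (βt * ‖d‖ + q) ^ 2
      ≤ (1 + βt ^ 2) / 2 * ‖d‖ ^ 2 + (1 + βt ^ 2) / (1 - βt ^ 2) * q ^ 2 := by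
    have h11 : (1 + βt ^ 2) / 2 * ‖d‖ ^ 2 + (1 + βt ^ 2) / (1 - βt ^ 2) * q ^ 2
        - (βt * ‖d‖ + q) ^ 2 = ((1 - βt ^ 2) * ‖d‖ - 2 * βt * q) ^ 2 / (2 * (1 - βt ^ 2)) := by
      field_simp
      ring
    have h12 : 0 ≤ ((1 - βt ^ 2) * ‖d‖ - 2 * βt * q) ^ 2 / (2 * (1 - βt ^ 2)) := by positivity
    linarith
  have h13 : q ^ 2 ≤ 2 * (a ^ 2 * (‖g‖ ^ 2 + Mr ^ 2)) := by
    have := mul_nonneg (sq_nonneg a) (sq_nonneg (‖g‖ - Mr))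
    rw [hq, mul_pow]
    linarith
  have h14 := mul_le_mul_of_nonneg_left h13
    (by positivity : 0 ≤ (1 + βt ^ 2) / (1 - βt ^ 2))
  calc _ ≤ _ := h9
    _ ≤ _ := h10
    _ ≤ (1 + βt ^ 2) / 2 * ‖d‖ ^ 2
        + (1 + βt ^ 2) / (1 - βt ^ 2) * (2 * (a ^ 2 * (‖g‖ ^ 2 + Mr ^ 2))) := by gcongr
    _ = _ := by ring

end StepLength

/-! ### Summation lemmas for real sequences -/

section Sequences

/-- Summation by parts against unimodal weights. -/
lemma sum_unimodal_mul_sub_le {c W : ℕ → ℝ} {B m : ℝ} {k₀ K : ℕ} (hK : k₀ ≤ K)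
    (hc0 : ∀ k, k₀ ≤ k → 0 ≤ c k) (hcm : ∀ k, k₀ ≤ k → c k ≤ m)
    (hc : ∀ k, k₀ ≤ k → c k ≤ c (k + 1) ∨ ∀ l, k ≤ l → c (l + 1) ≤ c l)
    (hW : ∀ k, |W k| ≤ B) :
    ∑ k ∈ Finset.Icc k₀ K, c k * (W (k + 1) - W k) ≤ 2 * B * m := by
  have hB : ∀ k, -B ≤ W k ∧ W k ≤ B := fun k => abs_le.1 (hW k)
  have hB0 : 0 ≤ B := (abs_nonneg _).trans (hW 0)
  -- The invariant has two phases. While the weights rise, the accumulated variation is at most `c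
  -- K`; once they fall, the total variation is at most `2 m - c K`. Adding the boundary term, at
  -- most `c K * B`, gives `2 B m` in both cases.
  have key : ∀ K, k₀ ≤ K →
      ((∑ k ∈ Finset.Icc k₀ K, c k * (W (k + 1) - W k) ≤ c K * W (K + 1) + c K * B) ∨
      ((∑ k ∈ Finset.Icc k₀ K, c k * (W (k + 1) - W k) ≤ c K * W (K + 1) + (2 * m - c K) * B) ∧
        ∀ l, K ≤ l → c (l + 1) ≤ c l)) := by
    intro K hK
    induction K, hK using Nat.le_induction with
    | base =>
      left
      have := mul_nonneg (hc0 k₀ le_rfl) (by linarith [(hB k₀).1] : 0 ≤ B + W k₀)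
      simp only [Finset.Icc_self, Finset.sum_singleton]
      linarith
    | succ K hK ih =>
      rw [Finset.sum_Icc_succ_top (by omega)]
      have hm1 := mul_nonneg (sub_nonneg.2 (hcm K hK)) hB0
      have hm2 := mul_nonneg (sub_nonneg.2 (hcm (K + 1) (by omega))) hB0
      have dec : (∀ l, K ≤ l → c (l + 1) ≤ c l) →
          ∑ k ∈ Finset.Icc k₀ K, c k * (W (k + 1) - W k) ≤ c K * W (K + 1) + (2 * m - c K) * B →
          (∑ k ∈ Finset.Icc k₀ K, c k * (W (k + 1) - W k))
            + c (K + 1) * (W (K + 1 + 1) - W (K + 1))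
            ≤ c (K + 1) * W (K + 1 + 1) + (2 * m - c (K + 1)) * B := by
        intro hd h
        have := mul_nonneg (sub_nonneg.2 (hd K le_rfl))
          (by linarith [(hB (K + 1)).2] : 0 ≤ B - W (K + 1))
        linarith
      rcases ih with h | ⟨h, hd⟩
      · rcases hc K hK with hi | hd
        · left
          have := mul_nonneg (sub_nonneg.2 hi) (by linarith [(hB (K + 1)).1] : 0 ≤ B + W (K + 1))
          linarith
        · right
          exact ⟨dec hd (by linarith), fun l hl => hd l (by omega)⟩
      · right
        exact ⟨dec hd h, fun l hl => hd l (by omega)⟩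
  have hm := mul_nonneg (sub_nonneg.2 (hcm K hK)) hB0
  have h2 := mul_nonneg (hc0 K hK) (by linarith [(hB (K + 1)).2] : 0 ≤ B - W (K + 1))
  rcases key K hK with h | ⟨h, _⟩ <;> linarith

/-- Weighted sum of the `j`-step increments of a bounded sequence, with unimodal weights. -/
lemma sum_unimodal_mul_delay_le {c e : ℕ → ℝ} {C m : ℝ} {k₀ K : ℕ} (hk₀ : 1 ≤ k₀) (hK : k₀ ≤ K)
    (hc0 : ∀ k, k₀ ≤ k → 0 ≤ c k) (hcm : ∀ k, k₀ ≤ k → c k ≤ m)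
    (hc : ∀ k, k₀ ≤ k → c k ≤ c (k + 1) ∨ ∀ l, k ≤ l → c (l + 1) ≤ c l)
    (he : ∀ k, |e k| ≤ C) (j : ℕ) :
    ∑ k ∈ Finset.Icc k₀ K, c k * (e k - e (k - j)) ≤ 2 * (j * C) * m := by
  have hW : ∀ k, |∑ i ∈ Finset.range j, e (k - 1 - i)| ≤ j * C := by
    intro k
    refine (Finset.abs_sum_le_sum_abs _ _).trans ?_
    refine (Finset.sum_le_card_nsmul _ _ C fun i _ => he _).trans ?_
    simp
  -- A `j`-step difference of `e` is a one-step difference of the moving sum `W k` of the `j`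
  -- preceding values, which is bounded by `j C`.
  refine le_trans (le_of_eq ?_) (sum_unimodal_mul_sub_le hK hc0 hcm hc hW)
  refine Finset.sum_congr rfl fun k hk => ?_
  have hk1 : 1 ≤ k := hk₀.trans (Finset.mem_Icc.1 hk).1
  congr 1
  have h1 : ∀ i, e (k - 1 - i) = e (k - (i + 1)) := fun i => by congr 1; omega
  simp only [Nat.add_sub_cancel, h1]
  rw [← Finset.sum_sub_distrib, Finset.sum_range_sub' (fun i => e (k - i)) j, Nat.sub_zero]

/-- Truncated subtraction sends all indices below the start to `0`, where `d` vanishes, so a shift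
only discards nonnegative terms. -/
lemma sum_shift_le {d : ℕ → ℝ} (hd0 : d 0 = 0) (hd : ∀ k, 0 ≤ d k) (i K : ℕ) :
    ∑ k ∈ Finset.range (K + 1), d (k - i) ≤ ∑ k ∈ Finset.range (K + 1), d k := by
  induction i with
  | zero => simp
  | succ i ih =>
    refine le_trans ?_ ih
    rw [Finset.sum_range_succ' (fun k => d (k - (i + 1))), Finset.sum_range_succ]
    simp only [Nat.zero_sub, hd0, add_zero, Nat.add_sub_add_right]
    linarith [hd (K - i)]

/-- Total squared length of the `j`-step increments in terms of that of the one-step ones. -/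
lemma sum_delay_sq_le {q : ℕ → ℕ → ℝ} {d : ℕ → ℝ} (hd0 : d 0 = 0) (hd : ∀ k, 0 ≤ d k)
    {k₀ K j : ℕ}
    (hq : ∀ k ∈ Finset.Icc k₀ K, q k j ≤ j * ∑ i ∈ Finset.range j, d (k - i)) :
    ∑ k ∈ Finset.Icc k₀ K, q k j ≤ (j : ℝ) ^ 2 * ∑ k ∈ Finset.range (K + 1), d k := by
  calc ∑ k ∈ Finset.Icc k₀ K, q k j
      ≤ ∑ k ∈ Finset.Icc k₀ K, j * ∑ i ∈ Finset.range j, d (k - i) := Finset.sum_le_sum hq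
    _ = j * ∑ i ∈ Finset.range j, ∑ k ∈ Finset.Icc k₀ K, d (k - i) := by
        rw [← Finset.mul_sum, Finset.sum_comm]
    _ ≤ j * ∑ i ∈ Finset.range j, ∑ k ∈ Finset.range (K + 1), d k := by
        gcongr with i _
        refine le_trans (Finset.sum_le_sum_of_subset_of_nonneg ?_ fun k _ _ => hd _)
          (sum_shift_le hd0 hd i K)
        intro k hk
        rw [Finset.mem_Icc] at hk
        rw [Finset.mem_range]
        omega
    _ = _ := by
        rw [Finset.sum_const, Finset.card_range, nsmul_eq_mul]
        ring

lemma inv_natCast_le_log_sub {k : ℕ} (hk : 1 ≤ k) :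
    1 / ((k : ℝ) + 1) ≤ Real.log ((k : ℝ) + 1) - Real.log k := by
  have hk' : (0 : ℝ) < k := by exact_mod_cast hk
  have h := Real.one_sub_inv_le_log_of_pos (x := ((k : ℝ) + 1) / k) (by positivity)
  rw [Real.log_div (by positivity) (by positivity), inv_div] at h
  refine le_trans (le_of_eq ?_) h
  field_simp
  ring

lemma sum_inv_Icc_le {k₀ K : ℕ} (hk₀ : 1 ≤ k₀) (hK : k₀ ≤ K) :
    ∑ k ∈ Finset.Icc k₀ K, 1 / (k : ℝ) ≤ 1 + Real.log K - Real.log k₀ := by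
  induction K, hK using Nat.le_induction with
  | base =>
    have : (1 : ℝ) ≤ k₀ := by exact_mod_cast hk₀
    simp only [Finset.Icc_self, Finset.sum_singleton, add_sub_cancel_right]
    exact (div_le_one (by positivity)).2 this
  | succ K hK ih =>
    rw [Finset.sum_Icc_succ_top (by omega)]
    have := inv_natCast_le_log_sub (hk₀.trans hK)
    push_cast
    linarith

lemma sqrt_sub_sqrt_le_sum {k₀ K : ℕ} (hk₀ : 1 ≤ k₀) (hK : k₀ ≤ K) :
    2 * (√((K : ℝ) + 1) - √(k₀ : ℝ)) ≤ ∑ k ∈ Finset.Icc k₀ K, 1 / √(k : ℝ) := by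
  -- After multiplication by `√k` this is `(√(k+1) - √k)² ≥ 0`.
  have step : ∀ k : ℕ, 1 ≤ k → 2 * (√((k : ℝ) + 1) - √(k : ℝ)) ≤ 1 / √(k : ℝ) := by
    intro k hk
    have hk' : (0 : ℝ) < k := by exact_mod_cast hk
    have h1 := Real.sqrt_pos.2 hk'
    rw [le_div_iff₀ h1]
    have h2 := Real.sq_sqrt hk'.le
    have h3 := Real.sq_sqrt (by positivity : (0 : ℝ) ≤ (k : ℝ) + 1)
    linarith [sq_nonneg (√((k : ℝ) + 1) - √(k : ℝ))]
  induction K, hK using Nat.le_induction with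
  | base => simpa using step k₀ hk₀
  | succ K hK ih =>
    rw [Finset.sum_Icc_succ_top (by omega)]
    have := step (K + 1) (by omega)
    push_cast at this ⊢
    linarith

end Sequences

/-! ### The step sizes `α / √k` -/

section StepSizes

variable {a : ℕ → ℝ} {α : ℝ}

lemma stepSize_pos (hα : 0 < α) (ha : ∀ k, 1 ≤ k → a k = α / √(k : ℝ)) {k : ℕ} (hk : 1 ≤ k) :
    0 < a k := by
  rw [ha k hk]
  have : (0 : ℝ) < k := by exact_mod_cast hk
  positivity

lemma stepSize_antitone (hα : 0 < α) (ha : ∀ k, 1 ≤ k → a k = α / √(k : ℝ)) {k l : ℕ}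
    (hk : 1 ≤ k) (hl : k ≤ l) : a l ≤ a k := by
  rw [ha k hk, ha l (hk.trans hl)]
  have : (0 : ℝ) < k := by exact_mod_cast hk
  gcongr

lemma stepSize_le (hα : 0 < α) (ha : ∀ k, 1 ≤ k → a k = α / √(k : ℝ)) {k : ℕ} (hk : 1 ≤ k) :
    a k ≤ α := by
  have h := stepSize_antitone hα ha le_rfl hk
  rw [ha 1 le_rfl] at h
  simpa using h

lemma sum_stepSize_sq_le (ha : ∀ k, 1 ≤ k → a k = α / √(k : ℝ)) {k₀ K : ℕ}
    (hk₀ : 1 ≤ k₀) (hK : k₀ ≤ K) :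
    ∑ k ∈ Finset.Icc k₀ K, a k ^ 2 ≤ α ^ 2 * (1 + Real.log K - Real.log k₀) := by
  calc ∑ k ∈ Finset.Icc k₀ K, a k ^ 2 = ∑ k ∈ Finset.Icc k₀ K, α ^ 2 * (1 / (k : ℝ)) := by
        refine Finset.sum_congr rfl fun k hk => ?_
        rw [ha k (hk₀.trans (Finset.mem_Icc.1 hk).1), div_pow, Real.sq_sqrt (Nat.cast_nonneg k)]
        ring
    _ ≤ _ := by
        rw [← Finset.mul_sum]
        exact mul_le_mul_of_nonneg_left (sum_inv_Icc_le hk₀ hK) (sq_nonneg α)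

/-- The weights `a_k (1 - a_k ρbar)` increase and then decrease. -/
lemma stepSize_unimodal (hα : 0 < α) (ha : ∀ k, 1 ≤ k → a k = α / √(k : ℝ)) {ρbar : ℝ}
    (hρ : 0 < ρbar) {k : ℕ} (hk : 1 ≤ k) :
    a k * (1 - a k * ρbar) ≤ a (k + 1) * (1 - a (k + 1) * ρbar) ∨
      ∀ l, k ≤ l → a (l + 1) * (1 - a (l + 1) * ρbar) ≤ a l * (1 - a l * ρbar) := by
  -- The sign of the increment is decided by `1 - ρbar (a l + a (l + 1))`, which grows with `l`
  -- because `a` decreases; it can therefore change sign only once.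
  have e : ∀ l, a l * (1 - a l * ρbar) - a (l + 1) * (1 - a (l + 1) * ρbar)
      = (a l - a (l + 1)) * (1 - ρbar * (a l + a (l + 1))) := fun l => by ring
  by_cases h : ρbar * (a k + a (k + 1)) ≤ 1
  · right
    intro l hl
    rw [← sub_nonneg, e]
    have h1 := stepSize_antitone hα ha hk hl
    have h2 := stepSize_antitone hα ha (by omega : 1 ≤ k + 1) (by omega : k + 1 ≤ l + 1)
    have h3 := stepSize_antitone hα ha (hk.trans hl) (Nat.le_succ l)
    refine mul_nonneg (sub_nonneg.2 h3) (sub_nonneg.2 (le_trans ?_ h))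
    gcongr
  · left
    rw [← sub_nonpos, e]
    refine mul_nonpos_of_nonneg_of_nonpos ?_ (by linarith)
    exact sub_nonneg.2 (stepSize_antitone hα ha hk (Nat.le_succ k))

end StepSizes

/-! ### Summing the descent inequality -/

/-- Summation of a recursive descent inequality with randomly delayed error terms. -/
lemma sum_descent_le {α ρ ρbar M CF κ Bd S : ℝ} {a p N Pe d e : ℕ → ℝ} {q : ℕ → ℕ → ℝ}
    {τmax k₀ K : ℕ} (hα : 0 < α) (ha : ∀ k, 1 ≤ k → a k = α / √(k : ℝ)) (hρbar : 0 < ρbar)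
    (haρ : ∀ k, 1 ≤ k → a k * ρbar ≤ 1) (hM : 0 ≤ M) (hκ : 0 ≤ κ) (hBd : 0 ≤ Bd)
    (hk₀ : 1 ≤ k₀) (hK : k₀ ≤ K)
    (hp0 : ∀ j ∈ Finset.range (τmax + 1), 0 ≤ p j) (hp1 : ∑ j ∈ Finset.range (τmax + 1), p j = 1)
    (hd0 : d 0 = 0) (hd : ∀ k, 0 ≤ d k) (hS : ∑ k ∈ Finset.range (K + 1), d k ≤ S)
    (he : ∀ k, |e k| ≤ CF) (hq0 : ∀ k j, 0 ≤ q k j)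
    (hq : ∀ k j, q k j ≤ j * ∑ i ∈ Finset.range j, d (k - i))
    (hstep : ∀ k ∈ Finset.Icc k₀ K, Pe (k + 1) + a k * (ρbar * (ρbar - ρ) / 2 * N k) ≤ Pe k
      + Bd * d k + 4 * ρbar * M ^ 2 * a k ^ 2
      + ρbar * (a k * (1 - a k * ρbar)) * ∑ j ∈ Finset.range (τmax + 1),
        p j * (M * √(q k j) + (e k - e (k - j)) + κ * q k j)) :
    ρbar * (ρbar - ρ) / 2 * ∑ k ∈ Finset.Icc k₀ K, a k * N k ≤ Pe k₀ - Pe (K + 1) + Bd * S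
      + 4 * ρbar * M ^ 2 * α ^ 2 * (1 + Real.log K - Real.log k₀)
      + 2 * (α / √(k₀ : ℝ)) * ρbar * τmax * CF
      + α / √(k₀ : ℝ) * (τmax : ℝ) ^ 2 * ρbar * κ * S
      + α * M * τmax * ρbar * √(1 + Real.log K - Real.log k₀) * √S := by
  have hCF : 0 ≤ CF := (abs_nonneg _).trans (he 0)
  have hS0 : 0 ≤ S := (Finset.sum_nonneg fun k _ => hd k).trans hS
  have hge : ∀ k ∈ Finset.Icc k₀ K, 1 ≤ k := fun k hk => hk₀.trans (Finset.mem_Icc.1 hk).1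
  set c : ℕ → ℝ := fun k => a k * (1 - a k * ρbar) with hcdef
  have hc0 : ∀ k, k₀ ≤ k → 0 ≤ c k := fun k hk =>
    mul_nonneg (stepSize_pos hα ha (hk₀.trans hk)).le (sub_nonneg.2 (haρ k (hk₀.trans hk)))
  have hca : ∀ k, k₀ ≤ k → c k ≤ a k := fun k hk => by
    have h1 := stepSize_pos hα ha (hk₀.trans hk)
    have : 0 ≤ a k * (a k * ρbar) := by positivity
    simp only [hcdef]
    linarith
  have hcm : ∀ k, k₀ ≤ k → c k ≤ α / √(k₀ : ℝ) := fun k hk =>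
    (hca k hk).trans ((stepSize_antitone hα ha hk₀ hk).trans (ha k₀ hk₀).le)
  have tel : ∑ k ∈ Finset.Icc k₀ K, (Pe k - Pe (k + 1)) = Pe k₀ - Pe (K + 1) := by
    clear hS hstep
    induction K, hK using Nat.le_induction with
    | base => simp
    | succ K hK ih =>
      rw [Finset.sum_Icc_succ_top (by omega), ih fun k hk => hk₀.trans (Finset.mem_Icc.1 hk).1]
      ring
  have hα2 := sum_stepSize_sq_le ha hk₀ hK
  have hdsum : ∑ k ∈ Finset.Icc k₀ K, d k ≤ S := by
    refine (Finset.sum_le_sum_of_subset_of_nonneg ?_ fun k _ _ => hd _).trans hS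
    intro k hk
    rw [Finset.mem_Icc] at hk
    rw [Finset.mem_range]
    omega
  have hlog : 0 ≤ 1 + Real.log K - Real.log k₀ :=
    (Finset.sum_nonneg fun k _ => by positivity).trans (sum_inv_Icc_le hk₀ hK)
  -- A bound valid for every fixed delay `j ≤ τmax`, hence for the average over `p`. Its terms come
  -- from the loss differences (unimodal weights), the squared displacements (`c k ≤ α / √k₀`) and
  -- the displacements (Cauchy–Schwarz against `a k`).
  set Y := 2 * (τmax * CF) * (α / √(k₀ : ℝ)) + κ * (α / √(k₀ : ℝ)) * ((τmax : ℝ) ^ 2 * S)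
    + M * (α * √(1 + Real.log K - Real.log k₀) * (τmax * √S)) with hY
  have hj : ∀ j ∈ Finset.range (τmax + 1), ∑ k ∈ Finset.Icc k₀ K,
      c k * (M * √(q k j) + (e k - e (k - j)) + κ * q k j) ≤ Y := by
    intro j hj
    have hjτ : (j : ℝ) ≤ τmax := by
      have : j ≤ τmax := Nat.lt_succ_iff.1 (Finset.mem_range.1 hj)
      exact_mod_cast this
    have hqs : ∑ k ∈ Finset.Icc k₀ K, q k j ≤ (τmax : ℝ) ^ 2 * S := by
      refine (sum_delay_sq_le hd0 hd fun k _ => hq k j).trans ?_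
      gcongr
      exact Finset.sum_nonneg fun k _ => hd k
    have h1 := sum_unimodal_mul_delay_le (c := c) hk₀ hK hc0 hcm
      (fun k hk => stepSize_unimodal hα ha hρbar (hk₀.trans hk)) he j
    have h2 : 2 * (j * CF) * (α / √(k₀ : ℝ)) ≤ 2 * (τmax * CF) * (α / √(k₀ : ℝ)) := by
      gcongr
    have h3 : ∑ k ∈ Finset.Icc k₀ K, c k * (κ * q k j)
        ≤ κ * (α / √(k₀ : ℝ)) * ((τmax : ℝ) ^ 2 * S) := by
      calc ∑ k ∈ Finset.Icc k₀ K, c k * (κ * q k j)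
          ≤ ∑ k ∈ Finset.Icc k₀ K, α / √(k₀ : ℝ) * (κ * q k j) :=
            Finset.sum_le_sum fun k hk => mul_le_mul_of_nonneg_right
              (hcm k (Finset.mem_Icc.1 hk).1) (mul_nonneg hκ (hq0 k j))
        _ = κ * (α / √(k₀ : ℝ)) * ∑ k ∈ Finset.Icc k₀ K, q k j := by
            rw [Finset.mul_sum]
            exact Finset.sum_congr rfl fun k _ => by ring
        _ ≤ _ := by gcongr
    have h4 : ∑ k ∈ Finset.Icc k₀ K, c k * (M * √(q k j))
        ≤ M * (α * √(1 + Real.log K - Real.log k₀) * (τmax * √S)) := by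
      calc ∑ k ∈ Finset.Icc k₀ K, c k * (M * √(q k j))
          ≤ ∑ k ∈ Finset.Icc k₀ K, a k * (M * √(q k j)) :=
            Finset.sum_le_sum fun k hk => mul_le_mul_of_nonneg_right
              (hca k (Finset.mem_Icc.1 hk).1) (by positivity)
        _ = M * ∑ k ∈ Finset.Icc k₀ K, a k * √(q k j) := by
            rw [Finset.mul_sum]
            exact Finset.sum_congr rfl fun k _ => by ring
        _ ≤ M * (√(∑ k ∈ Finset.Icc k₀ K, a k ^ 2) * √(∑ k ∈ Finset.Icc k₀ K, √(q k j) ^ 2)) := by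
            gcongr
            exact Real.sum_mul_le_sqrt_mul_sqrt _ _ _
        _ ≤ _ := by
            simp only [Real.sq_sqrt (hq0 _ j)]
            gcongr
            · refine (Real.sqrt_le_sqrt hα2).trans_eq ?_
              rw [Real.sqrt_mul (sq_nonneg α), Real.sqrt_sq hα.le]
            · refine (Real.sqrt_le_sqrt hqs).trans_eq ?_
              rw [Real.sqrt_mul (sq_nonneg _), Real.sqrt_sq (Nat.cast_nonneg _)]
    calc _ = ∑ k ∈ Finset.Icc k₀ K, c k * (M * √(q k j))
        + ∑ k ∈ Finset.Icc k₀ K, c k * (e k - e (k - j))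
        + ∑ k ∈ Finset.Icc k₀ K, c k * (κ * q k j) := by
          rw [← Finset.sum_add_distrib, ← Finset.sum_add_distrib]
          exact Finset.sum_congr rfl fun k _ => by ring
      _ ≤ Y := by
          rw [hY]
          linarith
  have hdelay : ∑ k ∈ Finset.Icc k₀ K, ρbar * c k * ∑ j ∈ Finset.range (τmax + 1),
      p j * (M * √(q k j) + (e k - e (k - j)) + κ * q k j) ≤ ρbar * Y := by
    calc _ = ρbar * ∑ j ∈ Finset.range (τmax + 1), p j * ∑ k ∈ Finset.Icc k₀ K,
          c k * (M * √(q k j) + (e k - e (k - j)) + κ * q k j) := by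
          simp only [Finset.mul_sum]
          rw [Finset.sum_comm]
          exact Finset.sum_congr rfl fun k _ => Finset.sum_congr rfl fun j _ => by ring
      _ ≤ ρbar * ∑ j ∈ Finset.range (τmax + 1), p j * Y :=
          mul_le_mul_of_nonneg_left (Finset.sum_le_sum fun j hj' =>
            mul_le_mul_of_nonneg_left (hj j hj') (hp0 j hj')) hρbar.le
      _ = ρbar * Y := by rw [← Finset.sum_mul, hp1, one_mul]
  have hsum := Finset.sum_le_sum hstep
  simp only [Finset.sum_add_distrib] at hsum
  rw [← Finset.mul_sum, ← Finset.mul_sum] at hsum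
  rw [Finset.sum_sub_distrib] at tel
  have h5 := mul_le_mul_of_nonneg_left hdsum hBd
  have h6 := mul_le_mul_of_nonneg_left hα2 (by positivity : 0 ≤ 4 * ρbar * M ^ 2)
  have h7 : ∑ k ∈ Finset.Icc k₀ K, a k * (ρbar * (ρbar - ρ) / 2 * N k)
      = ρbar * (ρbar - ρ) / 2 * ∑ k ∈ Finset.Icc k₀ K, a k * N k := by
    rw [Finset.mul_sum]
    exact Finset.sum_congr rfl fun k _ => by ring
  rw [h7] at hsum
  rw [hY] at hdelay
  linarith

/-! ### Independence: random indices and oracles at independent samples -/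

section Probability

variable {Ω : Type*} [MeasurableSpace Ω] {μ : Measure Ω}

lemma integrable_inner_of_memLp {V : Type*} [NormedAddCommGroup V] [InnerProductSpace ℝ V]
    {u v : Ω → V} (hu : MemLp u 2 μ) (hv : MemLp v 2 μ) :
    Integrable (fun ω => inner ℝ (u ω) (v ω)) μ := by
  refine (((memLp_two_iff_integrable_sq_norm hu.1).1 hu).add
    ((memLp_two_iff_integrable_sq_norm hv.1).1 hv)).mono' (hu.1.inner hv.1) ?_
  filter_upwards with ω
  refine (norm_inner_le_norm _ _).trans ?_
  simp only [Pi.add_apply]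
  nlinarith [sq_nonneg (‖u ω‖ - ‖v ω‖), sq_nonneg ‖u ω‖, sq_nonneg ‖v ω‖]

lemma integral_norm_le_sqrt [IsProbabilityMeasure μ] {V : Type*} [NormedAddCommGroup V]
    {u : Ω → V} (hu : MemLp u 2 μ) : ∫ ω, ‖u ω‖ ∂μ ≤ √(∫ ω, ‖u ω‖ ^ 2 ∂μ) := by
  refine Real.le_sqrt_of_sq_le ?_
  have h1 := (memLp_two_iff_integrable_sq_norm hu.1).1 hu
  have h2 : Integrable (fun ω => ‖u ω‖) μ := (hu.integrable one_le_two).norm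
  set m := ∫ ω, ‖u ω‖ ∂μ
  have h3 : 0 ≤ ∫ ω, (‖u ω‖ ^ 2 - 2 * m * ‖u ω‖ + m ^ 2) ∂μ :=
    integral_nonneg fun ω => by
      have := sq_nonneg (‖u ω‖ - m)
      simp only [Pi.zero_apply]
      linarith
  have h4 : Integrable (fun ω => ‖u ω‖ ^ 2 - 2 * m * ‖u ω‖) μ := h1.sub (h2.const_mul _)
  rw [integral_add h4 (integrable_const _), integral_sub h1 (h2.const_mul _), integral_const_mul] at h3
  simp only [integral_const, probReal_univ, one_smul] at h3
  change 0 ≤ _ - 2 * m * m + m ^ 2 at h3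
  linarith

/-- Integration of a family of variables evaluated at an independent random index. -/
lemma integral_comp_index [IsProbabilityMeasure μ] {N : Ω → ℕ} (hN : Measurable N)
    {s : Finset ℕ} (hs : ∑ j ∈ s, μ.real {ω | N ω = j} = 1) {Y : ℕ → Ω → ℝ}
    (hY : ∀ j ∈ s, Integrable (Y j) μ) (hind : ∀ j ∈ s, IndepFun N (Y j) μ) :
    Integrable (fun ω => Y (N ω) ω) μ ∧
      ∫ ω, Y (N ω) ω ∂μ = ∑ j ∈ s, μ.real {ω | N ω = j} * ∫ ω, Y j ω ∂μ := by
  have hm : ∀ j, MeasurableSet {ω | N ω = j} := fun j => hN (measurableSet_singleton j)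
  have hmem : ∀ᵐ ω ∂μ, N ω ∈ s := by
    have h1 : μ.real (⋃ j ∈ s, {ω | N ω = j}) = 1 := by
      rw [measureReal_biUnion_finset _ fun j _ => hm j, hs]
      intro i _ j _ hij
      refine Set.disjoint_left.2 fun ω hi hj => hij ?_
      rw [Set.mem_ofPred_eq] at hi hj
      exact hi.symm.trans hj
    have h2 : μ (⋃ j ∈ s, {ω | N ω = j}) = 1 := by
      rw [measureReal_def, ENNReal.toReal_eq_one_iff] at h1
      exact h1
    have h3 : ∀ᵐ ω ∂μ, ω ∈ ⋃ j ∈ s, {ω | N ω = j} :=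
      (mem_ae_iff_prob_eq_one (Finset.measurableSet_biUnion s fun j _ => hm j)).2 h2
    filter_upwards [h3] with ω hω
    simpa using hω
  -- The index lies in `s` almost surely, so the variable is a finite sum over its values;
  -- independence then factors each term.
  have hae : (fun ω => Y (N ω) ω) =ᵐ[μ]
      fun ω => ∑ j ∈ s, ({ω | N ω = j}.indicator (1 : Ω → ℝ) ω * Y j ω) := by
    filter_upwards [hmem] with ω hω
    rw [Finset.sum_eq_single (N ω)]
    · simp
    · intro j _ hj
      rw [Set.indicator_of_notMem (by simpa using hj.symm), zero_mul]
    · exact fun h => absurd hω h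
  have hind' : ∀ j ∈ s, IndepFun ({ω | N ω = j}.indicator (1 : Ω → ℝ)) (Y j) μ := by
    intro j hj
    have := (hind j hj).comp (φ := ({j} : Set ℕ).indicator (1 : ℕ → ℝ)) (ψ := id)
      measurable_from_top measurable_id
    exact this
  have hI : ∀ j, Integrable ({ω | N ω = j}.indicator (1 : Ω → ℝ)) μ := fun j =>
    (integrable_const (1 : ℝ)).indicator (hm j)
  have hint : ∀ j ∈ s, Integrable (fun ω => {ω | N ω = j}.indicator (1 : Ω → ℝ) ω * Y j ω) μ :=
    fun j hj => (hind' j hj).integrable_mul (hI j) (hY j hj)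
  refine ⟨(integrable_finsetSum s hint).congr hae.symm, ?_⟩
  rw [integral_congr_ae hae, integral_finsetSum s hint]
  refine Finset.sum_congr rfl fun j hj => ?_
  rw [(hind' j hj).integral_fun_mul_eq_mul_integral (hI j).1 (hY j hj).1,
    integral_indicator_one (hm j)]

variable {Ξ β : Type*} [MeasurableSpace Ξ] [MeasurableSpace β] {P : Measure Ξ}
  {V : Type*} [NormedAddCommGroup V] [MeasurableSpace V] [BorelSpace V] [SecondCountableTopology V]

/-- An oracle with bounded second moment, evaluated at an independent sample. -/
lemma memLp_oracle [IsProbabilityMeasure μ] [IsProbabilityMeasure P] {H : Ω → β} {ξ : Ω → Ξ}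
    (hH : Measurable H) (hξ : Measurable ξ) (hlaw : μ.map ξ = P) (hind : IndepFun ξ H μ)
    {g : V → Ξ → V} (hg : Measurable (Function.uncurry g)) {y : β → V} (hy : Measurable y) {M : ℝ}
    (hb : ∀ h, ∫⁻ s, ‖g (y h) s‖ₑ ^ 2 ∂P ≤ ENNReal.ofReal (M ^ 2)) :
    MemLp (fun ω => g (y (H ω)) (ξ ω)) 2 μ ∧ ∫ ω, ‖g (y (H ω)) (ξ ω)‖ ^ 2 ∂μ ≤ M ^ 2 := by
  -- Independence makes the joint law a product, so the sample can be integrated out first with the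
  -- past frozen.
  have hmap : μ.map (fun ω => (H ω, ξ ω)) = (μ.map H).prod P := by
    rw [← hlaw]
    exact (indepFun_iff_map_prod_eq_prod_map_map hH.aemeasurable hξ.aemeasurable).1 hind.symm
  have hprob : IsProbabilityMeasure (μ.map H) := Measure.isProbabilityMeasure_map hH.aemeasurable
  have hgy : Measurable fun p : β × Ξ => g (y p.1) p.2 :=
    hg.comp ((hy.comp measurable_fst).prodMk measurable_snd)
  have hmeas : Measurable fun ω => g (y (H ω)) (ξ ω) := hgy.comp (hH.prodMk hξ)
  have h1 : ∫⁻ ω, ‖g (y (H ω)) (ξ ω)‖ₑ ^ 2 ∂μ ≤ ENNReal.ofReal (M ^ 2) := by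
    calc ∫⁻ ω, ‖g (y (H ω)) (ξ ω)‖ₑ ^ 2 ∂μ
        = ∫⁻ p, ‖g (y p.1) p.2‖ₑ ^ 2 ∂(μ.map fun ω => (H ω, ξ ω)) :=
          (lintegral_map (hgy.enorm.pow_const 2) (hH.prodMk hξ)).symm
      _ = ∫⁻ h, ∫⁻ s, ‖g (y h) s‖ₑ ^ 2 ∂P ∂(μ.map H) := by
          rw [hmap, lintegral_prod _ (hgy.enorm.pow_const 2).aemeasurable]
      _ ≤ ∫⁻ _, ENNReal.ofReal (M ^ 2) ∂(μ.map H) := lintegral_mono hb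
      _ = ENNReal.ofReal (M ^ 2) := by simp
  have hLp : MemLp (fun ω => g (y (H ω)) (ξ ω)) 2 μ := by
    refine ⟨hmeas.aestronglyMeasurable, ?_⟩
    rw [eLpNorm_lt_top_iff_lintegral_rpow_enorm_lt_top (by simp) (by simp)]
    simpa using h1.trans_lt ENNReal.ofReal_lt_top
  refine ⟨hLp, ?_⟩
  rw [integral_eq_lintegral_of_nonneg_ae (Filter.Eventually.of_forall fun _ => sq_nonneg _)
    (hmeas.norm.pow_const 2).aestronglyMeasurable]
  refine ENNReal.toReal_le_of_le_ofReal (sq_nonneg M) (le_trans (le_of_eq ?_) h1)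
  refine lintegral_congr fun ω => ?_
  rw [ENNReal.ofReal_pow (norm_nonneg _), ofReal_norm]

/-- Inside an expectation, an oracle evaluated at an independent sample can be replaced by its
mean. -/
lemma integral_inner_oracle [InnerProductSpace ℝ V] [CompleteSpace V]
    [IsProbabilityMeasure μ] [IsProbabilityMeasure P] {H : Ω → β} {ξ : Ω → Ξ}
    (hH : Measurable H) (hξ : Measurable ξ) (hlaw : μ.map ξ = P)
    (hind : IndepFun ξ H μ) {g : V → Ξ → V} (hg : Measurable (Function.uncurry g)) {y u : β → V}
    (hy : Measurable y) (hu : Measurable u) {M : ℝ}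
    (hb : ∀ h, ∫⁻ s, ‖g (y h) s‖ₑ ^ 2 ∂P ≤ ENNReal.ofReal (M ^ 2))
    (hgi : ∀ h, Integrable (g (y h)) P)
    (huL : MemLp (fun ω => u (H ω)) 2 μ) :
    Integrable (fun ω => inner ℝ (u (H ω)) (∫ s, g (y (H ω)) s ∂P)) μ ∧
    ∫ ω, inner ℝ (u (H ω)) (g (y (H ω)) (ξ ω)) ∂μ
      = ∫ ω, inner ℝ (u (H ω)) (∫ s, g (y (H ω)) s ∂P) ∂μ := by
  have hmap : μ.map (fun ω => (H ω, ξ ω)) = (μ.map H).prod P := by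
    rw [← hlaw]
    exact (indepFun_iff_map_prod_eq_prod_map_map hH.aemeasurable hξ.aemeasurable).1 hind.symm
  have hprob : IsProbabilityMeasure (μ.map H) := Measure.isProbabilityMeasure_map hH.aemeasurable
  have hgy : Measurable fun p : β × Ξ => g (y p.1) p.2 :=
    hg.comp ((hy.comp measurable_fst).prodMk measurable_snd)
  have hψ : Measurable fun p : β × Ξ => (inner ℝ (u p.1) (g (y p.1) p.2) : ℝ) :=
    (hu.comp measurable_fst).inner hgy
  have hw : Measurable fun h => ∫ s, g (y h) s ∂P :=
    (hgy.stronglyMeasurable.integral_prod_right (ν := P)).measurable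
  have hint : Integrable (fun p : β × Ξ => (inner ℝ (u p.1) (g (y p.1) p.2) : ℝ))
      ((μ.map H).prod P) := by
    rw [← hmap, integrable_map_measure hψ.aestronglyMeasurable (hH.prodMk hξ).aemeasurable]
    exact integrable_inner_of_memLp huL (memLp_oracle hH hξ hlaw hind hg hy hb).1
  have hin : ∀ h, ∫ s, inner ℝ (u h) (g (y h) s) ∂P = inner ℝ (u h) (∫ s, g (y h) s ∂P) :=
    fun h => integral_inner (hgi h) (u h)
  constructor
  · have := hint.integral_prod_left
    simp only [hin] at this
    rwa [integrable_map_measure (hu.inner hw).aestronglyMeasurable hH.aemeasurable] at this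
  · calc ∫ ω, inner ℝ (u (H ω)) (g (y (H ω)) (ξ ω)) ∂μ
        = ∫ p, inner ℝ (u p.1) (g (y p.1) p.2) ∂(μ.map fun ω => (H ω, ξ ω)) :=
          (integral_map (hH.prodMk hξ).aemeasurable hψ.aestronglyMeasurable).symm
      _ = ∫ h, inner ℝ (u h) (∫ s, g (y h) s ∂P) ∂(μ.map H) := by
          rw [hmap, integral_prod _ hint]
          simp only [hin]
      _ = _ := integral_map hH.aemeasurable (hu.inner hw).aestronglyMeasurable

end Probability

/-! ### The past of the algorithm as a random variable -/

section History

variable {Ω Ξ : Type*}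

/-- Restriction of the samples and delays of the iterations `1, …, k - 1` to those of the
iterations `1, …, j - 1`. -/
def historyRestrict {j k : ℕ} (h : j ≤ k) (v : (Set.Ico 1 k → Ξ) × (Set.Ico 1 k → ℕ)) :
    (Set.Ico 1 j → Ξ) × (Set.Ico 1 j → ℕ) :=
  (fun i => v.1 ⟨i, i.2.1, i.2.2.trans_le h⟩, fun i => v.2 ⟨i, i.2.1, i.2.2.trans_le h⟩)

variable [MeasurableSpace Ξ]

lemma measurable_historyRestrict {j k : ℕ} (h : j ≤ k) :
    Measurable (historyRestrict (Ξ := Ξ) h) :=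
  (measurable_pi_lambda _ fun _ => (measurable_pi_apply _).comp measurable_fst).prodMk
    (measurable_pi_lambda _ fun _ => (measurable_pi_apply _).comp measurable_snd)

variable [MeasurableSpace Ω]

lemma measurable_history {ξ : ℕ → Ω → Ξ} {τ : ℕ → Ω → ℕ} (hξ : ∀ k, 1 ≤ k → Measurable (ξ k))
    (hτ : ∀ k, 1 ≤ k → Measurable (τ k)) (k : ℕ) : Measurable (history ξ τ k) :=
  (measurable_pi_lambda _ fun i : Set.Ico 1 k => hξ i i.2.1).prodMk
    (measurable_pi_lambda _ fun i : Set.Ico 1 k => hτ i i.2.1)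

end History

/-! ### Iterates as measurable functions of the past -/

section Iterates

variable {n : ℕ} {Ω Ξ : Type*} {r : EuclideanSpace ℝ (Fin n) → EReal}
  {G : ℕ → EuclideanSpace ℝ (Fin n) → Ξ → EuclideanSpace ℝ (Fin n)}
  {ξ : ℕ → Ω → Ξ} {τ : ℕ → Ω → ℕ} {a b : ℕ → ℝ} {x₀ : EuclideanSpace ℝ (Fin n)}
  {x : ℕ → Ω → EuclideanSpace ℝ (Fin n)}

lemma IsRun.mem_dom (hr : ProperClosedConvex r) (hx : IsRun r G ξ τ a b x₀ x) (k : ℕ) (ω : Ω) :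
    x k ω ∈ dom r := by
  match k with
  | 0 => rw [hx.zero]; exact hx.init_mem
  | 1 => rw [hx.one]; exact hx.init_mem
  | k + 2 => exact (hr.isProx_iff.1 (hx.step (k + 1) (by omega) ω)).1

/-- A selection of the proximal map is nonexpansive. -/
lemma IsProx.lipschitzWith_of_forall (hr : ProperClosedConvex r) {a : ℝ} (ha : 0 < a)
    {Z : EuclideanSpace ℝ (Fin n) → EuclideanSpace ℝ (Fin n)} (hZ : ∀ y, IsProx r a y (Z y)) :
    LipschitzWith 1 Z :=
  LipschitzWith.of_dist_le_mul fun y y' => by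
    simpa [dist_eq_norm] using (hZ y).dist_le hr ha (hZ y')

lemma IsProx.unique (hr : ProperClosedConvex r) {a : ℝ} (ha : 0 < a)
    {y z z' : EuclideanSpace ℝ (Fin n)} (h : IsProx r a y z) (h' : IsProx r a y z') : z = z' := by
  have := h.dist_le hr ha h'
  rw [sub_self, norm_zero] at this
  exact sub_eq_zero.1 (norm_le_zero_iff.1 this)

/-- Each iterate is a measurable function of the preceding samples and delays. -/
lemma IsRun.exists_eq_comp_history [MeasurableSpace Ξ] (hr : ProperClosedConvex r) {B : ℝ}
    (hB : ∀ y ∈ dom r, B ≤ (r y).toReal) (hG : ∀ k, 1 ≤ k → Measurable (Function.uncurry (G k)))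
    (ha : ∀ k, 1 ≤ k → 0 < a k) (hx : IsRun r G ξ τ a b x₀ x) (k : ℕ) :
    -- All earlier iterates are carried along because a step may read any of them through the delay.
    -- The representatives take values in `dom r` everywhere, since the oracle bounds are later
    -- integrated over all histories.
    ∀ j ≤ k, ∃ h : (Set.Ico 1 k → Ξ) × (Set.Ico 1 k → ℕ) → EuclideanSpace ℝ (Fin n),
      Measurable h ∧ (∀ v, h v ∈ dom r) ∧ ∀ ω, x j ω = h (history ξ τ k ω) := by
  induction k with
  | zero =>
    intro j hj
    obtain rfl : j = 0 := by omega
    exact ⟨fun _ => x₀, measurable_const, fun _ => hx.init_mem, hx.zero⟩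
  | succ k ih =>
    intro j hj
    rcases Nat.lt_or_ge k j with hkj | hjk
    · obtain rfl : j = k + 1 := by omega
      rcases Nat.eq_zero_or_pos k with rfl | hk
      · exact ⟨fun _ => x₀, measurable_const, fun _ => hx.init_mem, hx.one⟩
      · choose h hm hd hxh using ih
        choose Z hZ using hr.exists_isProx hB (ha k hk)
        have hZc := (IsProx.lipschitzWith_of_forall hr (ha k hk) hZ).continuous
        obtain ⟨res, hres, hresω⟩ : ∃ res : (Set.Ico 1 (k + 1) → Ξ) × (Set.Ico 1 (k + 1) → ℕ) →
            (Set.Ico 1 k → Ξ) × (Set.Ico 1 k → ℕ), Measurable res ∧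
              ∀ ω, res (history ξ τ (k + 1) ω) = history ξ τ k ω :=
          ⟨historyRestrict (Nat.le_succ k), measurable_historyRestrict _, fun _ => rfl⟩
        obtain ⟨t, ht, htω⟩ : ∃ t : (Set.Ico 1 (k + 1) → Ξ) × (Set.Ico 1 (k + 1) → ℕ) → ℕ,
            Measurable t ∧ ∀ ω, t (history ξ τ (k + 1) ω) = τ k ω :=
          ⟨fun v => v.2 ⟨k, hk, Nat.lt_succ_self k⟩,
            (measurable_pi_apply _).comp measurable_snd, fun _ => rfl⟩
        obtain ⟨s, hs, hsω⟩ : ∃ s : (Set.Ico 1 (k + 1) → Ξ) × (Set.Ico 1 (k + 1) → ℕ) → Ξ,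
            Measurable s ∧ ∀ ω, s (history ξ τ (k + 1) ω) = ξ k ω :=
          ⟨fun v => v.1 ⟨k, hk, Nat.lt_succ_self k⟩,
            (measurable_pi_apply _).comp measurable_fst, fun _ => rfl⟩
        -- Delays take countably many values, so measurability for each fixed delay suffices.
        have hdel : Measurable fun p : ((Set.Ico 1 k → Ξ) × (Set.Ico 1 k → ℕ)) × ℕ =>
            h (k - p.2) (Nat.sub_le _ _) p.1 :=
          measurable_from_prod_countable_left fun t => hm (k - t) (Nat.sub_le _ _)
        have hmk : Measurable fun v => h k le_rfl (res v) := (hm k le_rfl).comp hres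
        have hmk' : Measurable fun v => h (k - 1) (Nat.sub_le _ _) (res v) :=
          (hm (k - 1) _).comp hres
        have hg : Measurable fun v => G k (h (k - t v) (Nat.sub_le _ _) (res v)) (s v) :=
          (hG k hk).comp ((hdel.comp (hres.prodMk ht)).prodMk hs)
        refine ⟨fun v => Z (h k le_rfl (res v)
          - a k • G k (h (k - t v) (Nat.sub_le _ _) (res v)) (s v)
          + b k • (h k le_rfl (res v) - h (k - 1) (Nat.sub_le _ _) (res v))), ?_, ?_, ?_⟩
        · have h1 := hmk.sub (hg.const_smul (a k))
          have h2 := (hmk.sub hmk').const_smul (b k)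
          have h3 := h1.add h2
          exact hZc.measurable.comp h3
        · exact fun v => (hr.isProx_iff.1 (hZ _)).1
        · intro ω
          -- The run only says that the iterate is some minimizer; uniqueness identifies it with the
          -- continuous selection `Z`.
          refine IsProx.unique hr (ha k hk) (hx.step k hk ω) ?_
          simp only [hresω, htω, hsω, ← hxh]
          exact hZ _
    · obtain ⟨h, hm, hd, hxh⟩ := ih j hjk
      exact ⟨fun v => h (historyRestrict (Nat.le_succ k) v),
        hm.comp (measurable_historyRestrict _), fun v => hd _, hxh⟩

end Iterates

/-! ### Moments of the iterates and total squared step length -/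

/-- A run of the method driven by independent samples, with a bounded unbiased oracle. -/
structure IsStochasticRun {n : ℕ} {Ω Ξ : Type*} [MeasurableSpace Ω] [MeasurableSpace Ξ]
    (μ : Measure Ω) (P : Measure Ξ) (f : EuclideanSpace ℝ (Fin n) → Ξ → ℝ)
    (r : EuclideanSpace ℝ (Fin n) → EReal)
    (G : ℕ → EuclideanSpace ℝ (Fin n) → Ξ → EuclideanSpace ℝ (Fin n)) (M : ℝ)
    (ξ : ℕ → Ω → Ξ) (τ : ℕ → Ω → ℕ) (a b : ℕ → ℝ) (x₀ : EuclideanSpace ℝ (Fin n))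
    (x : ℕ → Ω → EuclideanSpace ℝ (Fin n)) : Prop where
  convex : ProperClosedConvex r
  bddBelow : ∃ B, ∀ y ∈ dom r, B ≤ (r y).toReal
  oracle : IsUnbiasedOracle P f r G
  nonneg : 0 ≤ M
  bounded : BoundedSubgradients P f r M
  sampling : IsSampling μ P ξ τ
  measurable_delay : ∀ k, 1 ≤ k → Measurable (τ k)
  stepSize_pos : ∀ k, 1 ≤ k → 0 < a k
  run : IsRun r G ξ τ a b x₀ x

namespace IsStochasticRun

variable {n : ℕ} {Ω Ξ : Type*} [MeasurableSpace Ω] [MeasurableSpace Ξ]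
  {μ : Measure Ω} {P : Measure Ξ}
  {f : EuclideanSpace ℝ (Fin n) → Ξ → ℝ} {r : EuclideanSpace ℝ (Fin n) → EReal}
  {G : ℕ → EuclideanSpace ℝ (Fin n) → Ξ → EuclideanSpace ℝ (Fin n)} {M : ℝ}
  {ξ : ℕ → Ω → Ξ} {τ : ℕ → Ω → ℕ} {a b : ℕ → ℝ} {x₀ : EuclideanSpace ℝ (Fin n)}
  {x : ℕ → Ω → EuclideanSpace ℝ (Fin n)}

lemma measurable_hist (h : IsStochasticRun μ P f r G M ξ τ a b x₀ x) (k : ℕ) :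
    Measurable (history ξ τ k) :=
  measurable_history h.sampling.measurable h.measurable_delay k

lemma exists_repr (h : IsStochasticRun μ P f r G M ξ τ a b x₀ x) {j k : ℕ} (hj : j ≤ k) :
    ∃ H : (Set.Ico 1 k → Ξ) × (Set.Ico 1 k → ℕ) → EuclideanSpace ℝ (Fin n),
      Measurable H ∧ (∀ v, H v ∈ dom r) ∧ ∀ ω, x j ω = H (history ξ τ k ω) := by
  obtain ⟨B, hB⟩ := h.bddBelow
  exact h.run.exists_eq_comp_history h.convex hB h.oracle.measurable h.stepSize_pos k j hj

lemma measurable_iterate (h : IsStochasticRun μ P f r G M ξ τ a b x₀ x) (k : ℕ) :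
    Measurable (x k) := by
  obtain ⟨H, hH, _, hxH⟩ := h.exists_repr (le_refl k)
  rw [funext hxH]
  exact hH.comp (h.measurable_hist k)

lemma mem_dom (h : IsStochasticRun μ P f r G M ξ τ a b x₀ x) (k : ℕ) (ω : Ω) : x k ω ∈ dom r :=
  h.run.mem_dom h.convex k ω

lemma exists_delayed_repr (h : IsStochasticRun μ P f r G M ξ τ a b x₀ x) (k : ℕ) :
    ∃ H : ((Set.Ico 1 k → Ξ) × (Set.Ico 1 k → ℕ)) × ℕ → EuclideanSpace ℝ (Fin n),
      Measurable H ∧ (∀ v, H v ∈ dom r) ∧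
        ∀ ω, x (k - τ k ω) ω = H (history ξ τ k ω, τ k ω) := by
  choose H hH hd hxH using fun j => h.exists_repr (Nat.sub_le k j)
  exact ⟨fun p => H p.2 p.1, measurable_from_prod_countable_left fun t => hH t,
    fun v => hd _ _, fun ω => hxH _ ω⟩

lemma integral_sq_step_one (h : IsStochasticRun μ P f r G M ξ τ a b x₀ x) :
    ∫ ω, ‖x 1 ω - x (1 - 1) ω‖ ^ 2 ∂μ = 0 := by
  simp [h.run.one, h.run.zero]

variable [IsProbabilityMeasure μ] [IsProbabilityMeasure P]

lemma memLp_gradient (h : IsStochasticRun μ P f r G M ξ τ a b x₀ x) {k : ℕ} (hk : 1 ≤ k) :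
    MemLp (fun ω => G k (x (k - τ k ω) ω) (ξ k ω)) 2 μ ∧
      ∫ ω, ‖G k (x (k - τ k ω) ω) (ξ k ω)‖ ^ 2 ∂μ ≤ M ^ 2 := by
  obtain ⟨H, hH, hd, hxH⟩ := h.exists_delayed_repr k
  simp only [hxH]
  exact memLp_oracle ((h.measurable_hist k).prodMk (h.measurable_delay k hk))
    (h.sampling.measurable k hk) (h.sampling.law k hk) (h.sampling.indep k hk)
    (h.oracle.measurable k hk) hH fun v => h.oracle.lintegral_sq_le h.bounded hk (hd v)

/-- The sample `ξ_k` is independent of the past together with `τ_k`, and these determine both `u`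
and the point where the oracle is queried. -/
lemma integral_inner_gradient (h : IsStochasticRun μ P f r G M ξ τ a b x₀ x) {k : ℕ}
    (hk : 1 ≤ k) {u : (Set.Ico 1 k → Ξ) × (Set.Ico 1 k → ℕ) → EuclideanSpace ℝ (Fin n)}
    (hu : Measurable u) (huL : MemLp (fun ω => u (history ξ τ k ω)) 2 μ) :
    Integrable (fun ω => inner ℝ (u (history ξ τ k ω)) (∫ s, G k (x (k - τ k ω) ω) s ∂P)) μ ∧
    ∫ ω, inner ℝ (u (history ξ τ k ω)) (G k (x (k - τ k ω) ω) (ξ k ω)) ∂μ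
      = ∫ ω, inner ℝ (u (history ξ τ k ω)) (∫ s, G k (x (k - τ k ω) ω) s ∂P) ∂μ := by
  obtain ⟨H, hH, hd, hxH⟩ := h.exists_delayed_repr k
  simp only [hxH]
  exact integral_inner_oracle (u := fun p => u p.1)
    ((h.measurable_hist k).prodMk (h.measurable_delay k hk))
    (h.sampling.measurable k hk) (h.sampling.law k hk) (h.sampling.indep k hk)
    (h.oracle.measurable k hk) hH (hu.comp measurable_fst)
    (fun v => h.oracle.lintegral_sq_le h.bounded hk (hd v))
    (fun v => (h.oracle.memLp h.bounded hk (hd v)).integrable one_le_two) huL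

/-- The proximal map is nonexpansive, so an iterate differs from the proximal point of `0` by at
most the norm of the argument of the step, which is square integrable by induction. -/
lemma memLp_iterate (h : IsStochasticRun μ P f r G M ξ τ a b x₀ x) (k : ℕ) :
    MemLp (x k) 2 μ := by
  induction k using Nat.strong_induction_on with
  | _ k ih =>
    match k with
    | 0 => rw [funext h.run.zero]; exact memLp_const x₀
    | 1 => rw [funext h.run.one]; exact memLp_const x₀
    | k + 2 =>
      obtain ⟨B, hB⟩ := h.bddBelow
      have ha := h.stepSize_pos (k + 1) (by omega)
      obtain ⟨z, hz⟩ := h.convex.exists_isProx hB ha 0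
      have h1 := ih (k + 1) (by omega)
      have h2 := ih k (by omega)
      have hg := (h.memLp_gradient (k := k + 1) (by omega)).1
      have hy := (h1.sub (hg.const_smul (a (k + 1)))).add ((h1.sub h2).const_smul (b (k + 1)))
      refine ((memLp_const z).norm.add hy.norm).mono
        (h.measurable_iterate _).aestronglyMeasurable ?_
      filter_upwards with ω
      have hp := (h.run.step (k + 1) (by omega) ω).dist_le h.convex ha hz
      rw [sub_zero] at hp
      refine le_trans ?_ (le_abs_self _)
      have := norm_sub_norm_le (x (k + 1 + 1) ω) z
      simp only [Pi.add_apply, Pi.sub_apply, Pi.smul_apply]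
      simp only [Nat.add_sub_cancel] at hp
      linarith

lemma integrable_sq_sub (h : IsStochasticRun μ P f r G M ξ τ a b x₀ x) (j k : ℕ) :
    Integrable (fun ω => ‖x k ω - x j ω‖ ^ 2) μ :=
  (memLp_two_iff_integrable_sq_norm ((h.memLp_iterate k).sub (h.memLp_iterate j)).1).1
    ((h.memLp_iterate k).sub (h.memLp_iterate j))

lemma integrable_sq_gradient (h : IsStochasticRun μ P f r G M ξ τ a b x₀ x) {k : ℕ}
    (hk : 1 ≤ k) : Integrable (fun ω => ‖G k (x (k - τ k ω) ω) (ξ k ω)‖ ^ 2) μ :=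
  (memLp_two_iff_integrable_sq_norm (h.memLp_gradient hk).1.1).1 (h.memLp_gradient hk).1

end IsStochasticRun

lemma sum_range_eq_sum_Icc_succ {D : ℕ → ℝ} (h0 : D 0 = 0) (h1 : D 1 = 0) (K : ℕ) :
    ∑ k ∈ Finset.range (K + 2), D k = ∑ k ∈ Finset.Icc 1 K, D (k + 1) := by
  induction K with
  | zero => simp [Finset.sum_range_succ, h0, h1]
  | succ K ih => rw [Finset.sum_range_succ, ih, Finset.sum_Icc_succ_top (by omega)]

lemma sum_Icc_one_eq_sum_range {D : ℕ → ℝ} (h0 : D 0 = 0) (K : ℕ) :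
    ∑ k ∈ Finset.Icc 1 K, D k = ∑ k ∈ Finset.range (K + 1), D k := by
  induction K with
  | zero => simp [h0]
  | succ K ih => rw [Finset.sum_range_succ, ← ih, Finset.sum_Icc_succ_top (by omega)]

/-- Summation of a contractive recursion. -/
lemma sum_range_le_of_recursion {D : ℕ → ℝ} {p q S : ℝ} {K : ℕ} (h0 : D 0 = 0) (h1 : D 1 = 0)
    (hD : ∀ k, 0 ≤ D k) (hq : 0 ≤ q) (hpq : q < p)
    (h : p * ∑ k ∈ Finset.Icc 1 K, D (k + 1) ≤ q * (∑ k ∈ Finset.Icc 1 K, D k) + S) :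
    ∑ k ∈ Finset.range (K + 1), D k ≤ S / (p - q) := by
  rw [sum_Icc_one_eq_sum_range h0, ← sum_range_eq_sum_Icc_succ h0 h1, Finset.sum_range_succ] at h
  rw [le_div_iff₀ (sub_pos.2 hpq)]
  have := mul_nonneg (hq.trans hpq.le) (hD (K + 1))
  linarith

namespace IsStochasticRun

variable {n : ℕ} {Ω Ξ : Type*} [MeasurableSpace Ω] [MeasurableSpace Ξ]
  {μ : Measure Ω} [IsProbabilityMeasure μ] {P : Measure Ξ} [IsProbabilityMeasure P]
  {f : EuclideanSpace ℝ (Fin n) → Ξ → ℝ} {r : EuclideanSpace ℝ (Fin n) → EReal}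
  {G : ℕ → EuclideanSpace ℝ (Fin n) → Ξ → EuclideanSpace ℝ (Fin n)} {M : ℝ}
  {ξ : ℕ → Ω → Ξ} {τ : ℕ → Ω → ℕ} {a b : ℕ → ℝ} {x₀ : EuclideanSpace ℝ (Fin n)}
  {x : ℕ → Ω → EuclideanSpace ℝ (Fin n)}

/-- Total squared step length for an objective that is bounded on its domain. -/
lemma sum_sq_step_le_of_boundedObjective (h : IsStochasticRun μ P f r G M ξ τ a b x₀ x)
    {ρ α βt Cφ : ℝ} (hF : WeaklyConvex ρ (expectedLoss P f)) (hρ : 0 < ρ) (hα : 0 < α)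
    (ha : ∀ k, 1 ≤ k → a k = α / √(k : ℝ)) (hb : ∀ k, 1 ≤ k → 0 ≤ b k ∧ b k ≤ βt)
    (hc : 0 < 1 - α * ρ / 2 - βt) (hφ : BoundedObjective (objective (expectedLoss P f) r) r Cφ)
    {K : ℕ} (hK : 1 ≤ K) :
    ∑ k ∈ Finset.range (K + 1), ∫ ω, ‖x k ω - x (k - 1) ω‖ ^ 2 ∂μ
      ≤ 4 * α * Cφ / (1 - α * ρ / 2 - βt)
        + 4 * M ^ 2 / (1 - α * ρ / 2 - βt) ^ 2 * α ^ 2 * (1 + Real.log K) := by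
  have hβt : 0 ≤ βt := (hb 1 le_rfl).1.trans (hb 1 le_rfl).2
  set c := 1 - α * ρ / 2 - βt with hcd
  set φ : EuclideanSpace ℝ (Fin n) → ℝ := fun y => expectedLoss P f y + (r y).toReal with hφd
  have hpath : ∀ ω, ∑ k ∈ Finset.Icc 1 K, ((1 - α * ρ / 2) / 2 * ‖x (k + 1) ω - x k ω‖ ^ 2
      - βt / 2 * ‖x k ω - x (k - 1) ω‖ ^ 2
      - a k ^ 2 / c * (‖G k (x (k - τ k ω) ω) (ξ k ω)‖ ^ 2 + M ^ 2)) ≤ 2 * Cφ * α := by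
    intro ω
    -- The decreases of `φ` are weighted by the nonincreasing `a k`, so summation by parts replaces
    -- telescoping and costs `2 Cφ α`.
    have h1 := sum_unimodal_mul_sub_le (c := a) (W := fun k => - φ (x k ω)) (B := Cφ) (m := α)
      hK (fun k hk => (h.stepSize_pos k hk).le) (fun k hk => stepSize_le hα ha hk)
      (fun k hk => Or.inr fun l hl => stepSize_antitone hα ha (hk.trans hl) (Nat.le_succ l))
      (fun k => by
        rw [abs_neg, hφd]
        have := hφ (x k ω) (h.mem_dom k ω)
        rwa [h.convex.toReal_objective _ (h.mem_dom k ω)] at this)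
    refine le_trans (Finset.sum_le_sum fun k hk => ?_) h1
    have hk := (Finset.mem_Icc.1 hk).1
    have h2 := (h.run.step k hk ω).step_sq_le_of_objective h.convex hρ
      (h.oracle.loss_sub_le h.nonneg h.bounded hF) (h.stepSize_pos k hk) (stepSize_le hα ha hk)
      (hb k hk).1 (hb k hk).2 hc (h.mem_dom k ω)
    rw [← hcd, mul_div_right_comm (a k ^ 2)] at h2
    simp only [hφd]
    linarith
  have i1 := fun k => (h.integrable_sq_sub k (k + 1)).const_mul ((1 - α * ρ / 2) / 2)
  have i2 := fun k => (h.integrable_sq_sub (k - 1) k).const_mul (βt / 2)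
  have i12 : ∀ k, Integrable (fun ω => (1 - α * ρ / 2) / 2 * ‖x (k + 1) ω - x k ω‖ ^ 2
      - βt / 2 * ‖x k ω - x (k - 1) ω‖ ^ 2) μ := fun k => (i1 k).sub (i2 k)
  have i3 : ∀ k, 1 ≤ k → Integrable (fun ω =>
      a k ^ 2 / c * (‖G k (x (k - τ k ω) ω) (ξ k ω)‖ ^ 2 + M ^ 2)) μ := fun k hk =>
    ((h.integrable_sq_gradient hk).add (integrable_const (M ^ 2))).const_mul (a k ^ 2 / c)
  have hint : ∀ k ∈ Finset.Icc 1 K, Integrable (fun ω =>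
      (1 - α * ρ / 2) / 2 * ‖x (k + 1) ω - x k ω‖ ^ 2 - βt / 2 * ‖x k ω - x (k - 1) ω‖ ^ 2
        - a k ^ 2 / c * (‖G k (x (k - τ k ω) ω) (ξ k ω)‖ ^ 2 + M ^ 2)) μ := fun k hk =>
    (i12 k).sub (i3 k (Finset.mem_Icc.1 hk).1)
  have hE := integral_mono (integrable_finsetSum _ hint)
    (integrable_const (μ := μ) (2 * Cφ * α)) hpath
  rw [integral_finsetSum _ hint] at hE
  have hk : ∀ k ∈ Finset.Icc 1 K, (1 - α * ρ / 2) / 2 * ∫ ω, ‖x (k + 1) ω - x k ω‖ ^ 2 ∂μ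
      - βt / 2 * ∫ ω, ‖x k ω - x (k - 1) ω‖ ^ 2 ∂μ - 2 * M ^ 2 / c * a k ^ 2
      ≤ ∫ ω, ((1 - α * ρ / 2) / 2 * ‖x (k + 1) ω - x k ω‖ ^ 2
        - βt / 2 * ‖x k ω - x (k - 1) ω‖ ^ 2
        - a k ^ 2 / c * (‖G k (x (k - τ k ω) ω) (ξ k ω)‖ ^ 2 + M ^ 2)) ∂μ := by
    intro k hk
    have hk1 := (Finset.mem_Icc.1 hk).1
    rw [integral_sub (i12 k) (i3 k hk1), integral_sub (i1 k) (i2 k), integral_const_mul,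
      integral_const_mul, integral_const_mul,
      integral_add (h.integrable_sq_gradient hk1) (integrable_const _)]
    simp only [integral_const, probReal_univ, one_smul]
    have h3 := (h.memLp_gradient hk1).2
    have h4 : 2 * M ^ 2 / c * a k ^ 2 = a k ^ 2 / c * (M ^ 2 + M ^ 2) := by ring
    rw [h4]
    gcongr
  have hsum := (Finset.sum_le_sum hk).trans hE
  simp only [Finset.sum_sub_distrib, ← Finset.mul_sum, integral_const, probReal_univ,
    one_smul] at hsum
  have hα2 := sum_stepSize_sq_le ha le_rfl hK
  rw [Nat.cast_one, Real.log_one, sub_zero] at hα2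
  have h5 := mul_le_mul_of_nonneg_left hα2 (by positivity : 0 ≤ 2 * M ^ 2 / c)
  -- Here `p - q` is half of `c`; dividing by it produces the factors in the constants. The first
  -- step contributes nothing because `x⁽⁰⁾ = x⁽¹⁾`.
  have h6 := sum_range_le_of_recursion
    (D := fun k => ∫ ω, ‖x k ω - x (k - 1) ω‖ ^ 2 ∂μ) (K := K) (p := (1 - α * ρ / 2) / 2)
    (q := βt / 2) (S := 2 * Cφ * α + 2 * M ^ 2 / c * (α ^ 2 * (1 + Real.log K))) (by simp)
    h.integral_sq_step_one (fun k => integral_nonneg fun ω => sq_nonneg _) (by positivity)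
    (by linarith) (by simp only [Nat.add_sub_cancel]; linarith)
  refine h6.trans (le_of_eq ?_)
  rw [show (1 - α * ρ / 2) / 2 - βt / 2 = c / 2 by rw [hcd]; ring]
  field_simp
  ring

/-- Total squared step length for a regularizer that is Lipschitz on its domain. -/
lemma sum_sq_step_le_of_indicatorPlus (h : IsStochasticRun μ P f r G M ξ τ a b x₀ x)
    {α βt Mr : ℝ} (hα : 0 < α) (ha : ∀ k, 1 ≤ k → a k = α / √(k : ℝ))
    (hb : ∀ k, 1 ≤ k → 0 ≤ b k ∧ b k ≤ βt) (hβ1 : βt < 1) (hMr : 0 ≤ Mr)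
    (hr : IndicatorPlusBoundedSubgradients r Mr) {K : ℕ} (hK : 1 ≤ K) :
    ∑ k ∈ Finset.range (K + 1), ∫ ω, ‖x k ω - x (k - 1) ω‖ ^ 2 ∂μ
      ≤ (Mr ^ 2 + M ^ 2) * (4 * (1 + βt ^ 2) / (1 - βt ^ 2) ^ 2) * α ^ 2
        * (1 + Real.log K) := by
  have hβt : 0 ≤ βt := (hb 1 le_rfl).1.trans (hb 1 le_rfl).2
  have hB : 0 < 1 - βt ^ 2 := by nlinarith
  have hstep : ∀ k ∈ Finset.Icc 1 K, ∫ ω, ‖x (k + 1) ω - x k ω‖ ^ 2 ∂μ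
      ≤ (1 + βt ^ 2) / 2 * ∫ ω, ‖x k ω - x (k - 1) ω‖ ^ 2 ∂μ
        + 2 * (1 + βt ^ 2) / (1 - βt ^ 2) * (Mr ^ 2 + M ^ 2) * a k ^ 2 := by
    intro k hk
    have hk := (Finset.mem_Icc.1 hk).1
    have i1 := (h.integrable_sq_sub (k - 1) k).const_mul ((1 + βt ^ 2) / 2)
    have i2 := (((h.integrable_sq_gradient hk).add (integrable_const (Mr ^ 2))).const_mul
      (a k ^ 2)).const_mul (2 * (1 + βt ^ 2) / (1 - βt ^ 2))
    have hE := integral_mono (h.integrable_sq_sub k (k + 1)) (i1.add i2) (fun ω => by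
      simpa using (h.run.step k hk ω).step_sq_le_of_lipschitz h.convex hMr
        (fun x hx y hy => hr.toReal_sub_le hx hy) (h.stepSize_pos k hk) (hb k hk).1 (hb k hk).2
        hβ1 (h.mem_dom k ω))
    refine hE.trans ((integral_add i1 i2).le.trans ?_)
    rw [integral_const_mul, integral_const_mul, integral_const_mul]
    simp only [Pi.add_apply]
    rw [integral_add (h.integrable_sq_gradient hk) (integrable_const _)]
    simp only [integral_const, probReal_univ, one_smul]
    have h3 := (h.memLp_gradient hk).2
    calc _ ≤ (1 + βt ^ 2) / 2 * ∫ ω, ‖x k ω - x (k - 1) ω‖ ^ 2 ∂μ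
        + 2 * (1 + βt ^ 2) / (1 - βt ^ 2) * (a k ^ 2 * (M ^ 2 + Mr ^ 2)) := by gcongr
      _ = _ := by ring
  have hsum := Finset.sum_le_sum hstep
  rw [Finset.sum_add_distrib, ← Finset.mul_sum, ← Finset.mul_sum] at hsum
  have hα2 := sum_stepSize_sq_le ha le_rfl hK
  rw [Nat.cast_one, Real.log_one, sub_zero] at hα2
  have h5 := mul_le_mul_of_nonneg_left hα2
    (by positivity : 0 ≤ 2 * (1 + βt ^ 2) / (1 - βt ^ 2) * (Mr ^ 2 + M ^ 2))
  have h6 := sum_range_le_of_recursion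
    (D := fun k => ∫ ω, ‖x k ω - x (k - 1) ω‖ ^ 2 ∂μ) (K := K) (p := 1)
    (q := (1 + βt ^ 2) / 2)
    (S := 2 * (1 + βt ^ 2) / (1 - βt ^ 2) * (Mr ^ 2 + M ^ 2) * (α ^ 2 * (1 + Real.log K)))
    (by simp) h.integral_sq_step_one (fun k => integral_nonneg fun ω => sq_nonneg _)
    (by positivity) (by linarith) (by simp only [Nat.add_sub_cancel]; linarith)
  refine h6.trans (le_of_eq ?_)
  rw [show 1 - (1 + βt ^ 2) / 2 = (1 - βt ^ 2) / 2 by ring]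
  field_simp
  ring

end IsStochasticRun

/-! ### Expected descent of the Moreau envelope -/

lemma integrable_expectedLoss {n : ℕ} {Ω Ξ : Type*} [MeasurableSpace Ω] [MeasurableSpace Ξ]
    {μ : Measure Ω} [IsFiniteMeasure μ] {P : Measure Ξ}
    {f : EuclideanSpace ℝ (Fin n) → Ξ → ℝ} {r : EuclideanSpace ℝ (Fin n) → EReal} {ρ CF : ℝ}
    (hF : WeaklyConvex ρ (expectedLoss P f)) (hCF : ∀ y ∈ dom r, |expectedLoss P f y| ≤ CF)
    {y : Ω → EuclideanSpace ℝ (Fin n)} (hy : Measurable y) (hyd : ∀ ω, y ω ∈ dom r) :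
    Integrable (fun ω => expectedLoss P f (y ω)) μ :=
  (integrable_const CF).mono' (hF.continuous.measurable.comp hy).aestronglyMeasurable
    (Filter.Eventually.of_forall fun ω => hCF _ (hyd ω))

namespace IsStochasticRun

variable {n : ℕ} {Ω Ξ : Type*} [MeasurableSpace Ω] [MeasurableSpace Ξ]
  {μ : Measure Ω} [IsProbabilityMeasure μ] {P : Measure Ξ} [IsProbabilityMeasure P]
  {f : EuclideanSpace ℝ (Fin n) → Ξ → ℝ} {r : EuclideanSpace ℝ (Fin n) → EReal}
  {G : ℕ → EuclideanSpace ℝ (Fin n) → Ξ → EuclideanSpace ℝ (Fin n)} {M : ℝ}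
  {ξ : ℕ → Ω → Ξ} {τ : ℕ → Ω → ℕ} {a b : ℕ → ℝ} {x₀ : EuclideanSpace ℝ (Fin n)}
  {x : ℕ → Ω → EuclideanSpace ℝ (Fin n)}

lemma memLp_comp_lipschitz (h : IsStochasticRun μ P f r G M ξ τ a b x₀ x) {L : ℝ} (k : ℕ)
    {Z : EuclideanSpace ℝ (Fin n) → EuclideanSpace ℝ (Fin n)} (hZm : Measurable Z)
    (hZ : ∀ y y', ‖Z y - Z y'‖ ≤ L * ‖y - y'‖) : MemLp (fun ω => Z (x k ω)) 2 μ := by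
  refine ((memLp_const (Z 0)).norm.add ((h.memLp_iterate k).norm.const_mul L)).mono
    (hZm.comp (h.measurable_iterate k)).aestronglyMeasurable ?_
  filter_upwards with ω
  refine le_trans ?_ (le_abs_self _)
  have h1 := hZ (x k ω) 0
  rw [sub_zero] at h1
  have h2 := norm_sub_norm_le (Z (x k ω)) (Z 0)
  simp only [Pi.add_apply]
  linarith

/-- The envelope lies between the optimal value and its test value at `x₀`, a constant plus a
multiple of the integrable `‖x₀ - x k‖²`. -/
lemma integrable_moreauEnvelope (h : IsStochasticRun μ P f r G M ξ τ a b x₀ x) {lam : ℝ}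
    (hb : ⊥ < ⨅ y, objective (expectedLoss P f) r y) (hlam : 0 < lam)
    (hmeas : Measurable (moreauEnvelope (objective (expectedLoss P f) r) lam))
    (hZ : ∀ y, ∃ z, IsProx (objective (expectedLoss P f) r) lam y z) (k : ℕ) :
    Integrable (fun ω => moreauEnvelope (objective (expectedLoss P f) r) lam (x k ω)) μ := by
  have hx₀ := h.run.init_mem
  have h1 : Integrable (fun ω => ‖x₀ - x k ω‖ ^ 2) μ := by
    have := h.integrable_sq_sub k 0
    simpa only [h.run.zero] using this
  refine ((integrable_const (|optimalValue (objective (expectedLoss P f) r)|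
    + |expectedLoss P f x₀ + (r x₀).toReal|)).add (h1.const_mul (1 / (2 * lam)))).mono'
    (hmeas.comp (h.measurable_iterate k)).aestronglyMeasurable ?_
  filter_upwards with ω
  obtain ⟨z, hz⟩ := hZ (x k ω)
  have h2 := moreauEnvelope_le h.convex hz hx₀
  have h3 := optimalValue_le h.convex hb ((h.convex.isProx_objective_iff _).1 hz).1
  have h4 := moreauEnvelope_eq h.convex hz
  have h5 : 0 ≤ 1 / (2 * lam) * ‖z - x k ω‖ ^ 2 := by positivity
  have h6 : 0 ≤ 1 / (2 * lam) * ‖x₀ - x k ω‖ ^ 2 := by positivity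
  have h7 := neg_abs_le (optimalValue (objective (expectedLoss P f) r))
  have h8 := le_abs_self (expectedLoss P f x₀ + (r x₀).toReal)
  have h9 := abs_nonneg (optimalValue (objective (expectedLoss P f) r))
  have h10 := abs_nonneg (expectedLoss P f x₀ + (r x₀).toReal)
  simp only [Pi.add_apply, Real.norm_eq_abs]
  rw [abs_le]
  constructor <;> linarith

/-- Mean squared `j`-step increment in terms of the one-step ones. -/
lemma integral_sq_delay_le (h : IsStochasticRun μ P f r G M ξ τ a b x₀ x) (k j : ℕ) :
    ∫ ω, ‖x k ω - x (k - j) ω‖ ^ 2 ∂μ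
      ≤ j * ∑ i ∈ Finset.range j, ∫ ω, ‖x (k - i) ω - x (k - i - 1) ω‖ ^ 2 ∂μ := by
  have hi : ∀ i ∈ Finset.range j,
      Integrable (fun ω => ‖x (k - i) ω - x (k - i - 1) ω‖ ^ 2) μ :=
    fun i _ => h.integrable_sq_sub _ _
  rw [← integral_finsetSum _ hi, ← integral_const_mul]
  refine integral_mono (h.integrable_sq_sub _ _) ((integrable_finsetSum _ hi).const_mul _)
    fun ω => ?_
  have h1 : x k ω - x (k - j) ω = ∑ i ∈ Finset.range j, (x (k - i) ω - x (k - i - 1) ω) := by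
    simp only [Nat.sub_sub]
    rw [Finset.sum_range_sub' (fun i => x (k - i) ω) j, Nat.sub_zero]
  have h2 := norm_sum_le (Finset.range j) fun i => x (k - i) ω - x (k - i - 1) ω
  rw [← h1] at h2
  calc ‖x k ω - x (k - j) ω‖ ^ 2
      ≤ (∑ i ∈ Finset.range j, ‖x (k - i) ω - x (k - i - 1) ω‖) ^ 2 :=
        pow_le_pow_left₀ (norm_nonneg _) h2 2
    _ ≤ _ := by
        simpa using sq_sum_le_card_mul_sum_sq (s := Finset.range j)
          (f := fun i => ‖x (k - i) ω - x (k - i - 1) ω‖)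

/-- Lower bound of the mean inner product of `x - prox x` with the delayed stochastic
subgradient. -/
lemma integral_inner_gradient_ge (h : IsStochasticRun μ P f r G M ξ τ a b x₀ x)
    {ρ ρbar CF L : ℝ} (hF : WeaklyConvex ρ (expectedLoss P f)) (hρ : 0 < ρ) (hρbar : ρ < ρbar)
    (hCF : ∀ y ∈ dom r, |expectedLoss P f y| ≤ CF)
    {Z : EuclideanSpace ℝ (Fin n) → EuclideanSpace ℝ (Fin n)} (hZm : Measurable Z)
    (hZd : ∀ y, Z y ∈ dom r) (hZL : ∀ y y', ‖Z y - Z y'‖ ≤ L * ‖y - y'‖)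
    {τmax : ℕ} {p : ℕ → ℝ} (hτ : IsStochasticDelay μ ξ τ τmax p) {k : ℕ} (hk : 1 ≤ k) :
    (∫ ω, expectedLoss P f (x k ω) ∂μ) - (∫ ω, expectedLoss P f (Z (x k ω)) ∂μ)
      - (ρ / 2 + (ρbar - ρ) / 4) * (∫ ω, ‖x k ω - Z (x k ω)‖ ^ 2 ∂μ)
      - ∑ j ∈ Finset.range (τmax + 1), p j * (M * √(∫ ω, ‖x k ω - x (k - j) ω‖ ^ 2 ∂μ)
        + ((∫ ω, expectedLoss P f (x k ω) ∂μ) - ∫ ω, expectedLoss P f (x (k - j) ω) ∂μ)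
        + (ρ / 2 + ρ ^ 2 / (ρbar - ρ)) * ∫ ω, ‖x k ω - x (k - j) ω‖ ^ 2 ∂μ)
      ≤ ∫ ω, inner ℝ (x k ω - Z (x k ω)) (G k (x (k - τ k ω) ω) (ξ k ω)) ∂μ := by
  set F := expectedLoss P f with hFd
  set κ := ρ / 2 + ρ ^ 2 / (ρbar - ρ) with hκ
  obtain ⟨H, hH, hHd, hxH⟩ := h.exists_repr (le_refl k)
  have hzL := h.memLp_comp_lipschitz k hZm hZL
  have hxz : MemLp (fun ω => x k ω - Z (x k ω)) 2 μ := (h.memLp_iterate k).sub hzL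
  have hN := (memLp_two_iff_integrable_sq_norm hxz.1).1 hxz
  obtain ⟨hwi, hw⟩ := h.integral_inner_gradient hk (u := fun v => H v - Z (H v))
    (hH.sub (hZm.comp hH)) (by simpa only [hxH] using hxz)
  simp only [← hxH] at hwi hw
  rw [hw]
  have hFx : ∀ j, Integrable (fun ω => F (x j ω)) μ := fun j =>
    integrable_expectedLoss hF hCF (h.measurable_iterate j) (h.mem_dom j)
  have hFz : Integrable (fun ω => F (Z (x k ω))) μ :=
    integrable_expectedLoss hF hCF (hZm.comp (h.measurable_iterate k)) fun ω => hZd _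
  let Y : ℕ → Ω → ℝ := fun j ω => M * ‖x k ω - x (k - j) ω‖ + (F (x k ω) - F (x (k - j) ω))
    + κ * ‖x k ω - x (k - j) ω‖ ^ 2
  have hdL : ∀ j, MemLp (fun ω => x k ω - x (k - j) ω) 2 μ := fun j =>
    (h.memLp_iterate k).sub (h.memLp_iterate (k - j))
  have i1 : ∀ j, Integrable (fun ω => M * ‖x k ω - x (k - j) ω‖) μ := fun j =>
    (((hdL j).integrable one_le_two).norm).const_mul M
  have i2 : ∀ j, Integrable (fun ω => F (x k ω) - F (x (k - j) ω)) μ := fun j =>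
    (hFx k).sub (hFx (k - j))
  have i12 : ∀ j, Integrable (fun ω => M * ‖x k ω - x (k - j) ω‖
      + (F (x k ω) - F (x (k - j) ω))) μ := fun j => (i1 j).add (i2 j)
  have i3 : ∀ j, Integrable (fun ω => κ * ‖x k ω - x (k - j) ω‖ ^ 2) μ := fun j =>
    (h.integrable_sq_sub (k - j) k).const_mul κ
  have hY : ∀ j, Integrable (Y j) μ := fun j => (i12 j).add (i3 j)
  -- For a fixed `j`, `Y j` is a function of the past alone, and `τ_k` is independent of the past.
  have hYind : ∀ j, IndepFun (τ k) (Y j) μ := by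
    intro j
    obtain ⟨H', hH', _, hxH'⟩ := h.exists_repr (Nat.sub_le k j)
    have hm := hF.continuous.measurable
    have hψ : Measurable fun v => M * ‖H v - H' v‖ + (F (H v) - F (H' v))
        + κ * ‖H v - H' v‖ ^ 2 :=
      ((((hH.sub hH').norm).const_mul M).add ((hm.comp hH).sub (hm.comp hH'))).add
        (((hH.sub hH').norm.pow_const 2).const_mul κ)
    have hYH : Y j = (fun v => M * ‖H v - H' v‖ + (F (H v) - F (H' v))
        + κ * ‖H v - H' v‖ ^ 2) ∘ history ξ τ k := by
      funext ω
      simp only [Y, Function.comp_apply, hxH, hxH']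
    rw [hYH]
    exact (hτ.indep k hk).comp (φ := id) measurable_id hψ
  have hps : ∑ j ∈ Finset.range (τmax + 1), μ.real {ω | τ k ω = j} = 1 := by
    rw [← hτ.sum_eq_one]
    exact Finset.sum_congr rfl fun j hj => hτ.law k hk j (Nat.lt_succ_iff.1 (Finset.mem_range.1 hj))
  obtain ⟨hYi, hYe⟩ := integral_comp_index (hτ.measurable k hk) hps (Y := Y)
    (fun j _ => hY j) (fun j _ => hYind j)
  have hYle : ∫ ω, Y (τ k ω) ω ∂μ ≤ ∑ j ∈ Finset.range (τmax + 1),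
      p j * (M * √(∫ ω, ‖x k ω - x (k - j) ω‖ ^ 2 ∂μ)
        + ((∫ ω, F (x k ω) ∂μ) - ∫ ω, F (x (k - j) ω) ∂μ)
        + κ * ∫ ω, ‖x k ω - x (k - j) ω‖ ^ 2 ∂μ) := by
    rw [hYe]
    refine Finset.sum_le_sum fun j hj => ?_
    rw [hτ.law k hk j (Nat.lt_succ_iff.1 (Finset.mem_range.1 hj))]
    refine mul_le_mul_of_nonneg_left ?_ ?_
    · simp only [Y]
      rw [integral_add (i12 j) (i3 j), integral_add (i1 j) (i2 j), integral_sub (hFx k) (hFx _),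
        integral_const_mul, integral_const_mul]
      have := mul_le_mul_of_nonneg_left (integral_norm_le_sqrt (hdL j)) h.nonneg
      linarith
    · rw [← hτ.law k hk j (Nat.lt_succ_iff.1 (Finset.mem_range.1 hj))]
      exact measureReal_nonneg
  have j1 : Integrable (fun ω => F (x k ω) - F (Z (x k ω))) μ := (hFx k).sub hFz
  have j2 := hN.const_mul (ρ / 2 + (ρbar - ρ) / 4)
  have j12 : Integrable (fun ω => F (x k ω) - F (Z (x k ω))
      - (ρ / 2 + (ρbar - ρ) / 4) * ‖x k ω - Z (x k ω)‖ ^ 2) μ := j1.sub j2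
  have hE : ∫ ω, (F (x k ω) - F (Z (x k ω))
      - (ρ / 2 + (ρbar - ρ) / 4) * ‖x k ω - Z (x k ω)‖ ^ 2 - Y (τ k ω) ω) ∂μ
      ≤ ∫ ω, inner ℝ (x k ω - Z (x k ω)) (∫ s, G k (x (k - τ k ω) ω) s ∂P) ∂μ := by
    refine integral_mono (j12.sub hYi) hwi fun ω => ?_
    have := h.oracle.delayed_inner_ge h.nonneg h.bounded hF hρ hρbar hk (x := x k ω)
      (h.mem_dom (k - τ k ω) ω) (Z (x k ω))
    simp only [Y]
    rw [← hκ, ← hFd] at this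
    linarith
  rw [integral_sub j12 hYi, integral_sub j1 j2, integral_sub (hFx k) hFz,
    integral_const_mul] at hE
  linarith

/-- Expected decrease of the Moreau envelope along one iteration. -/
lemma expected_descent (h : IsStochasticRun μ P f r G M ξ τ a b x₀ x)
    {ρ ρbar CF L : ℝ} (hF : WeaklyConvex ρ (expectedLoss P f)) (hρ : 0 < ρ) (hρbar : ρ < ρbar)
    (hρbar2 : ρbar ≤ 2 * ρ) (hbdd : ⊥ < ⨅ y, objective (expectedLoss P f) r y)
    (hCF : ∀ y ∈ dom r, |expectedLoss P f y| ≤ CF)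
    (hmeas : Measurable (moreauEnvelope (objective (expectedLoss P f) r) (1 / ρbar)))
    {Z : EuclideanSpace ℝ (Fin n) → EuclideanSpace ℝ (Fin n)} (hZm : Measurable Z)
    (hZ : ∀ y, IsProx (objective (expectedLoss P f) r) (1 / ρbar) y (Z y))
    (hZL : ∀ y y', ‖Z y - Z y'‖ ≤ L * ‖y - y'‖)
    {τmax : ℕ} {p : ℕ → ℝ} (hτ : IsStochasticDelay μ ξ τ τmax p) {k : ℕ} (hk : 1 ≤ k)
    (haρ : a k * ρbar ≤ 1) (hb : 0 ≤ b k) :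
    (∫ ω, moreauEnvelope (objective (expectedLoss P f) r) (1 / ρbar) (x (k + 1) ω) ∂μ)
      + a k * (ρbar * (ρbar - ρ) / 2 * ∫ ω, ‖x k ω - Z (x k ω)‖ ^ 2 ∂μ)
      ≤ (∫ ω, moreauEnvelope (objective (expectedLoss P f) r) (1 / ρbar) (x k ω) ∂μ)
        + ρbar / 2 * (2 * b k ^ 2 + 2 * (b k ^ 2 / a k) / (ρbar - ρ))
          * (∫ ω, ‖x k ω - x (k - 1) ω‖ ^ 2 ∂μ)
        + 4 * ρbar * M ^ 2 * a k ^ 2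
        + ρbar * (a k * (1 - a k * ρbar)) * ∑ j ∈ Finset.range (τmax + 1),
          p j * (M * √(∫ ω, ‖x k ω - x (k - j) ω‖ ^ 2 ∂μ)
          + ((∫ ω, expectedLoss P f (x k ω) ∂μ) - ∫ ω, expectedLoss P f (x (k - j) ω) ∂μ)
          + (ρ / 2 + ρ ^ 2 / (ρbar - ρ)) * ∫ ω, ‖x k ω - x (k - j) ω‖ ^ 2 ∂μ) := by
  have hZd : ∀ y, Z y ∈ dom r := fun y => ((h.convex.isProx_objective_iff _).1 (hZ y)).1
  have hinner := h.integral_inner_gradient_ge hF hρ hρbar hCF hZm hZd hZL hτ hk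
  set F := expectedLoss P f with hFd
  set Φ := moreauEnvelope (objective F r) (1 / ρbar) with hΦ
  have hρb0 : 0 < ρbar := hρ.trans hρbar
  have hδ : 0 < ρbar - ρ := sub_pos.2 hρbar
  have ha := h.stepSize_pos k hk
  set c := 1 - a k * ρbar with hc
  have hc0 : 0 ≤ c := sub_nonneg.2 haρ
  have hc1 : c ≤ 1 := by
    have := mul_pos ha hρb0
    linarith
  have hlam : 1 / (2 * (1 / ρbar)) = ρbar / 2 := by
    rw [one_div, mul_inv, one_div, inv_inv]
    ring
  -- The contraction `c² - 1` of the squared distance, the Young cost of inertia and the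
  -- weak-convexity term of the one-step estimate are gathered here; the delay cost joins in `h3` at
  -- the end.
  set A₁ := ρbar / 2 * (c ^ 2 - 1 + a k * (ρbar - ρ) / 2 + a k * c * ρ) with hA₁
  set A₂ := ρbar / 2 * (2 * b k ^ 2 + 2 * (b k ^ 2 / a k) / (ρbar - ρ)) with hA₂
  set A₃ := ρbar * (a k * c) with hA₃
  set A₄ := 2 * ρbar * a k ^ 2 with hA₄
  have hpath : ∀ ω, Φ (x (k + 1) ω) ≤ Φ (x k ω) + A₁ * ‖x k ω - Z (x k ω)‖ ^ 2
      + A₂ * ‖x k ω - x (k - 1) ω‖ ^ 2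
      - A₃ * inner ℝ (x k ω - Z (x k ω)) (G k (x (k - τ k ω) ω) (ξ k ω))
      + A₃ * (F (x k ω) - F (Z (x k ω)))
      + A₄ * (‖G k (x (k - τ k ω) ω) (ξ k ω)‖ ^ 2 + M ^ 2) := by
    intro ω
    set y := x k ω
    set z := Z y
    set d := y - x (k - 1) ω
    set g := G k (x (k - τ k ω) ω) (ξ k ω)
    have h1 := moreauEnvelope_le h.convex (hZ (x (k + 1) ω)) (hZd y)
    have h2 := moreauEnvelope_eq h.convex (hZ y)
    have h3 := (hZ y).dist_prox_sq_le h.convex hF h.nonneg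
      (h.oracle.loss_sub_le h.nonneg h.bounded hF) ha (mul_pos ha hρb0).le haρ (h.mem_dom k ω)
      (h.run.step k hk ω)
    rw [hlam, ← hΦ] at h1 h2
    rw [norm_sub_rev] at h1 h2
    -- This Young weight leaves `b k ^ 2 / a k` on `‖d‖²`, which is why the inertia must decay like
    -- `k^(-1/4)`.
    have h4 : 2 * c * b k * inner ℝ (y - z) d
        ≤ a k * (ρbar - ρ) / 2 * ‖y - z‖ ^ 2 + 2 * (b k ^ 2 / a k) / (ρbar - ρ) * ‖d‖ ^ 2 := by
      have h5 : c * (b k * inner ℝ (y - z) d) ≤ b k * (‖y - z‖ * ‖d‖) := by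
        have h6 : b k * inner ℝ (y - z) d ≤ b k * (‖y - z‖ * ‖d‖) :=
          mul_le_mul_of_nonneg_left (real_inner_le_norm _ _) hb
        have h7 : 0 ≤ b k * (‖y - z‖ * ‖d‖) := by positivity
        calc c * (b k * inner ℝ (y - z) d) ≤ c * (b k * (‖y - z‖ * ‖d‖)) :=
              mul_le_mul_of_nonneg_left h6 hc0
          _ ≤ _ := mul_le_of_le_one_left h7 hc1
      have h8 : a k * (ρbar - ρ) / 2 * ‖y - z‖ ^ 2
          + 2 * (b k ^ 2 / a k) / (ρbar - ρ) * ‖d‖ ^ 2 - 2 * (b k * (‖y - z‖ * ‖d‖))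
          = (a k * (ρbar - ρ) * ‖y - z‖ - 2 * b k * ‖d‖) ^ 2 / (2 * (a k * (ρbar - ρ))) := by
        field_simp
        ring
      have h9 : 0 ≤ (a k * (ρbar - ρ) * ‖y - z‖ - 2 * b k * ‖d‖) ^ 2
        / (2 * (a k * (ρbar - ρ))) := by positivity
      linarith
    have h10 : Φ (x (k + 1) ω) ≤ Φ y + ρbar / 2 * (‖x (k + 1) ω - z‖ ^ 2 - ‖y - z‖ ^ 2) := by
      linarith
    have h11 := mul_le_mul_of_nonneg_left (h3.trans (by
      have : 2 * c * b k * inner ℝ (y - z) d ≤ _ := h4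
      exact add_le_add_left (add_le_add_left (add_le_add_left (sub_le_sub_right
        (add_le_add_right this _) _) _) _) _)) (by positivity : 0 ≤ ρbar / 2)
    rw [hA₁, hA₂, hA₃, hA₄]
    linarith
  have hΦi := h.integrable_moreauEnvelope hbdd (one_div_pos.2 hρb0) hmeas fun y => ⟨_, hZ y⟩
  rw [← hFd, ← hΦ] at hΦi
  have hxz : MemLp (fun ω => x k ω - Z (x k ω)) 2 μ :=
    (h.memLp_iterate k).sub (h.memLp_comp_lipschitz k hZm hZL)
  have hFx : Integrable (fun ω => F (x k ω)) μ :=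
    integrable_expectedLoss hF hCF (h.measurable_iterate k) (h.mem_dom k)
  have hFz : Integrable (fun ω => F (Z (x k ω))) μ :=
    integrable_expectedLoss hF hCF (hZm.comp (h.measurable_iterate k)) fun ω => hZd _
  have hg2 := h.integrable_sq_gradient hk
  have i0 := hΦi k
  have i1 := ((memLp_two_iff_integrable_sq_norm hxz.1).1 hxz).const_mul A₁
  have i2 := (h.integrable_sq_sub (k - 1) k).const_mul A₂
  have i3 := (integrable_inner_of_memLp hxz (h.memLp_gradient hk).1).const_mul A₃
  have i4 : Integrable (fun ω => A₃ * (F (x k ω) - F (Z (x k ω)))) μ :=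
    (hFx.sub hFz).const_mul A₃
  have i5 : Integrable (fun ω => A₄ * (‖G k (x (k - τ k ω) ω) (ξ k ω)‖ ^ 2 + M ^ 2)) μ :=
    (hg2.add (integrable_const (M ^ 2))).const_mul A₄
  have s1 : Integrable (fun ω => Φ (x k ω) + A₁ * ‖x k ω - Z (x k ω)‖ ^ 2) μ := i0.add i1
  have s2 : Integrable (fun ω => Φ (x k ω) + A₁ * ‖x k ω - Z (x k ω)‖ ^ 2
      + A₂ * ‖x k ω - x (k - 1) ω‖ ^ 2) μ := s1.add i2
  have s3 : Integrable (fun ω => Φ (x k ω) + A₁ * ‖x k ω - Z (x k ω)‖ ^ 2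
      + A₂ * ‖x k ω - x (k - 1) ω‖ ^ 2
      - A₃ * inner ℝ (x k ω - Z (x k ω)) (G k (x (k - τ k ω) ω) (ξ k ω))) μ := s2.sub i3
  have s4 : Integrable (fun ω => Φ (x k ω) + A₁ * ‖x k ω - Z (x k ω)‖ ^ 2
      + A₂ * ‖x k ω - x (k - 1) ω‖ ^ 2
      - A₃ * inner ℝ (x k ω - Z (x k ω)) (G k (x (k - τ k ω) ω) (ξ k ω))
      + A₃ * (F (x k ω) - F (Z (x k ω)))) μ := s3.add i4
  have hE := integral_mono (hΦi (k + 1)) (s4.add i5) hpath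
  simp only [Pi.add_apply] at hE
  rw [integral_add s4 i5, integral_add s3 i4, integral_sub s2 i3, integral_add s1 i2,
    integral_add i0 i1, integral_const_mul, integral_const_mul, integral_const_mul,
    integral_const_mul, integral_const_mul, integral_sub hFx hFz,
    integral_add hg2 (integrable_const _)] at hE
  simp only [integral_const, probReal_univ, one_smul] at hE
  have h1 := mul_le_mul_of_nonneg_left hinner (by positivity : 0 ≤ A₃)
  have h2 := mul_le_mul_of_nonneg_left (h.memLp_gradient hk).2 (by positivity : 0 ≤ A₄)
  set N := ∫ ω, ‖x k ω - Z (x k ω)‖ ^ 2 ∂μ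
  have hN : 0 ≤ N := integral_nonneg fun ω => sq_nonneg _
  -- Inside the factor `ρbar / 2`, the terms linear in `a k` amount to `-2 (ρbar - ρ)` from
  -- contraction and weak convexity, plus half of `ρbar - ρ` from each of inertia and delay. The
  -- quadratic terms have the right sign because `ρbar ≤ 2ρ`.
  have h3 : A₁ + A₃ * (ρ / 2 + (ρbar - ρ) / 4) ≤ - (a k * (ρbar * (ρbar - ρ) / 2)) := by
    have h4 : - (a k * (ρbar * (ρbar - ρ) / 2)) - (A₁ + A₃ * (ρ / 2 + (ρbar - ρ) / 4))
        = ρbar / 2 * (a k * (ρbar * (a k * (2 * ρ - ρbar)) + ρbar * (a k * (ρbar - ρ)) / 2)) := by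
      rw [hA₁, hA₃, hc]
      ring
    have h5 : 0 ≤ 2 * ρ - ρbar := by linarith
    have h6 : 0 ≤ ρbar / 2 * (a k * (ρbar * (a k * (2 * ρ - ρbar))
      + ρbar * (a k * (ρbar - ρ)) / 2)) := by positivity
    linarith
  have h4 := mul_le_mul_of_nonneg_right h3 hN
  have h5 : A₄ * (M ^ 2 + M ^ 2) = 4 * ρbar * M ^ 2 * a k ^ 2 := by
    rw [hA₄]
    ring
  linarith

end IsStochasticRun

end InertialSsGM

/-! ### Assembly of the bound -/

theorem mainTheorem5 {n : ℕ} {Ω Ξ : Type*} [MeasurableSpace Ω] [MeasurableSpace Ξ]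
    (μ : Measure Ω) [IsProbabilityMeasure μ] (P : Measure Ξ) [IsProbabilityMeasure P]
    -- the problem: minimize `φ = F + r` with `F = 𝔼 f(·; ξ)`
    (f : EuclideanSpace ℝ (Fin n) → Ξ → ℝ) (hf : ∀ x, Integrable (f x) P)
    (F : EuclideanSpace ℝ (Fin n) → ℝ) (hF : F = expectedLoss P f)
    (r : EuclideanSpace ℝ (Fin n) → EReal) (hr : ProperClosedConvex r)
    (φ : EuclideanSpace ℝ (Fin n) → EReal) (hφ : φ = objective F r)
    (hφ_bdd : ⊥ < ⨅ x, φ x)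
    -- weak convexity, unbiased and bounded stochastic subgradients, stochastic delay
    (ρ : ℝ) (hρ : 0 < ρ) (hF_weak : WeaklyConvex ρ F)
    (G : ℕ → EuclideanSpace ℝ (Fin n) → Ξ → EuclideanSpace ℝ (Fin n))
    (hG : IsUnbiasedOracle P f r G)
    (M : ℝ) (hM : 0 ≤ M) (hG_bdd : BoundedSubgradients P f r M)
    (ξ : ℕ → Ω → Ξ) (τ : ℕ → Ω → ℕ) (τmax : ℕ) (p : ℕ → ℝ)
    (hξ : IsSampling μ P ξ τ) (hτ : IsStochasticDelay μ ξ τ τmax p)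
    -- parameters
    (ρbar : ℝ) (hρbar : ρbar ∈ Set.Ioc ρ (2 * ρ))
    (α : ℝ) (hα : 0 < α) (hα_le : α ≤ 1 / ρbar)
    (βt β : ℝ) (hβt : 0 ≤ βt) (hβt_lt : βt < 1 - α * ρ / 2) (hβ : 0 ≤ β)
    (a b : ℕ → ℝ) (ha : ∀ k, 1 ≤ k → a k = α / √(k : ℝ))
    (hb : ∀ k, 1 ≤ k → b k = min βt (β / (k : ℝ) ^ (1 / 4 : ℝ)))
    (CF : ℝ) (hCF : ∀ x ∈ dom r, |F x| ≤ CF)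
    -- at least one of the two additional conditions, with the resulting constants `C₁`, `C₂`
    (C₁ C₂ : ℝ)
    (hC : (∃ Cφ : ℝ, BoundedObjective φ r Cφ ∧
          C₁ = 4 * α * Cφ / (1 - α * ρ / 2 - βt) ∧
          C₂ = 4 * M ^ 2 / (1 - α * ρ / 2 - βt) ^ 2) ∨
        (∃ Mr : ℝ, 0 ≤ Mr ∧ IndicatorPlusBoundedSubgradients r Mr ∧
          C₁ = 0 ∧
          C₂ = (Mr ^ 2 + M ^ 2) * (4 * (1 + βt ^ 2) / (1 - βt ^ 2) ^ 2)))
    -- the iterates and the randomly selected output index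
    (x₀ : EuclideanSpace ℝ (Fin n)) (x : ℕ → Ω → EuclideanSpace ℝ (Fin n))
    (hx : IsRun r G ξ τ a b x₀ x)
    (k₀ K : ℕ) (hk₀ : 1 ≤ k₀) (hK : k₀ ≤ K)
    (T : Ω → ℕ) (hT : IsOutputIndex μ ξ τ a k₀ K T) :
    Differentiable ℝ (moreauEnvelope φ (1 / ρbar)) ∧
    Integrable (fun ω => moreauEnvelope φ (1 / ρbar) (x k₀ ω)) μ ∧
    Integrable (fun ω => ‖gradient (moreauEnvelope φ (1 / ρbar)) (x (T ω) ω)‖ ^ 2) μ ∧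
    ∫ ω, ‖gradient (moreauEnvelope φ (1 / ρbar)) (x (T ω) ω)‖ ^ 2 ∂μ ≤
      ρbar / ((ρbar - ρ) * α * (√((K : ℝ) + 1) - √(k₀ : ℝ))) *
        ((∫ ω, (moreauEnvelope φ (1 / ρbar) (x k₀ ω) - optimalValue φ) ∂μ)
          + 4 * ρbar * M ^ 2 * α ^ 2 * (1 + Real.log K - Real.log k₀)
          + ρbar / 2 * (2 * βt ^ 2 + 2 * β ^ 2 / (α * (ρbar - ρ)))
              * (C₁ + C₂ * α ^ 2 * (1 + Real.log K))
          + 2 * (α / √(k₀ : ℝ)) * ρbar * τmax * CF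
          + α / √(k₀ : ℝ) * (τmax : ℝ) ^ 2 * ρbar * (ρ / 2 + ρ ^ 2 / (ρbar - ρ))
              * (C₁ + C₂ * α ^ 2 * (1 + Real.log K))
          + α * M * τmax * ρbar * √(1 + Real.log K - Real.log k₀)
              * √(C₁ + C₂ * α ^ 2 * (1 + Real.log K))) := by
  subst hF
  subst hφ
  obtain ⟨hρlt, hρbar2⟩ := hρbar
  have hρb0 : 0 < ρbar := hρ.trans hρlt
  have hδ : 0 < ρbar - ρ := sub_pos.2 hρlt
  have hαρbar : α * ρbar ≤ 1 := by rwa [le_div_iff₀ hρb0] at hα_le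
  have hlam : 0 < 1 / ρbar := one_div_pos.2 hρb0
  have hlamρ : 1 / ρbar * ρ < 1 := by
    rw [one_div, ← div_eq_inv_mul, div_lt_one hρb0]
    exact hρlt
  have hopt : ∀ y ∈ dom r, optimalValue (objective (expectedLoss P f) r)
      ≤ expectedLoss P f y + (r y).toReal := fun y hy => optimalValue_le hr hφ_bdd hy
  have hpos : ∀ k, 1 ≤ k → 0 < a k := fun k hk => stepSize_pos hα ha hk
  have haρ : ∀ k, 1 ≤ k → a k * ρbar ≤ 1 := fun k hk =>
    (mul_le_mul_of_nonneg_right (stepSize_le hα ha hk) hρb0.le).trans hαρbar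
  have hb' : ∀ k, 1 ≤ k → 0 ≤ b k ∧ b k ≤ βt := fun k hk => by
    rw [hb k hk]
    exact ⟨le_min hβt (by positivity), min_le_left _ _⟩
  have h : IsStochasticRun μ P f r G M ξ τ a b x₀ x :=
    { convex := hr
      -- `r` is the objective minus `F`, with the objective at least its optimal value and `F ≤ CF`.
      bddBelow := ⟨optimalValue (objective (expectedLoss P f) r) - CF, fun y hy => by
        have h1 := hopt y hy
        have h2 := le_of_abs_le (hCF y hy)
        linarith⟩
      oracle := hG
      nonneg := hM
      bounded := hG_bdd
      sampling := hξ
      measurable_delay := hτ.measurable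
      stepSize_pos := hpos
      run := hx }
  choose Z hZ using hr.exists_isProx_objective hF_weak.continuous hopt hlam
  have hgrad := hasGradientAt_moreauEnvelope hr hF_weak hlam hlamρ hZ
  have hZL : ∀ y y', ‖Z y - Z y'‖ ≤ 1 / (1 - 1 / ρbar * ρ) * ‖y - y'‖ := fun y y' =>
    (hZ y).objective_dist_le hr hF_weak hlam hlamρ (hZ y')
  have hZm : Measurable Z := by
    have h1 : 0 ≤ 1 / (1 - 1 / ρbar * ρ) := one_div_nonneg.2 (by linarith)
    exact (LipschitzWith.of_dist_le_mul (K := ⟨_, h1⟩) fun y y' => by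
      rw [dist_eq_norm, dist_eq_norm]
      exact hZL y y').continuous.measurable
  have hdiff : Differentiable ℝ (moreauEnvelope (objective (expectedLoss P f) r) (1 / ρbar)) :=
    fun y => (hgrad y).differentiableAt
  have hmeas := hdiff.continuous.measurable
  have hΦi := h.integrable_moreauEnvelope hφ_bdd hlam hmeas fun y => ⟨_, hZ y⟩
  have hnorm : ∀ y, ‖gradient (moreauEnvelope (objective (expectedLoss P f) r) (1 / ρbar)) y‖ ^ 2
      = ρbar ^ 2 * ‖y - Z y‖ ^ 2 := fun y => by
    rw [(hgrad y).gradient, norm_smul, mul_pow, one_div, inv_inv, Real.norm_of_nonneg hρb0.le]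
  have hxz : ∀ k, Integrable (fun ω => ρbar ^ 2 * ‖x k ω - Z (x k ω)‖ ^ 2) μ := fun k => by
    have h1 : MemLp (fun ω => x k ω - Z (x k ω)) 2 μ :=
      (h.memLp_iterate k).sub (h.memLp_comp_lipschitz k hZm hZL)
    exact ((memLp_two_iff_integrable_sq_norm h1.1).1 h1).const_mul _
  obtain ⟨A, hA⟩ : ∃ A, A = ∑ j ∈ Finset.Icc k₀ K, a j := ⟨_, rfl⟩
  have hK1 : 1 ≤ K := hk₀.trans hK
  have hA0 : 0 < A := hA ▸ Finset.sum_pos (fun k hk => hpos k (hk₀.trans (Finset.mem_Icc.1 hk).1))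
    ⟨k₀, Finset.left_mem_Icc.2 hK⟩
  have hprob : ∑ k ∈ Finset.Icc k₀ K, μ.real {ω | T ω = k} = 1 := by
    rw [Finset.sum_congr rfl hT.law, ← Finset.sum_div, ← hA, div_self hA0.ne']
  have hTind : ∀ k ∈ Finset.Icc k₀ K,
      IndepFun T (fun ω => ρbar ^ 2 * ‖x k ω - Z (x k ω)‖ ^ 2) μ := fun k hk => by
    -- `x⁽ᵏ⁾` with `k ≤ K` depends only on iterations `1, …, K - 1`, exactly the data from which `T`
    -- is independent.
    obtain ⟨H, hH, _, hxH⟩ := h.exists_repr (Finset.mem_Icc.1 hk).2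
    have hψ : Measurable fun v => ρbar ^ 2 * ‖H v - Z (H v)‖ ^ 2 :=
      ((hH.sub (hZm.comp hH)).norm.pow_const 2).const_mul _
    have e : (fun ω => ρbar ^ 2 * ‖x k ω - Z (x k ω)‖ ^ 2)
        = (fun v => ρbar ^ 2 * ‖H v - Z (H v)‖ ^ 2) ∘ history ξ τ K := by
      funext ω
      simp only [Function.comp_apply, hxH]
    rw [e]
    exact hT.indep.comp (φ := id) measurable_id hψ
  obtain ⟨hTi, hTe⟩ := integral_comp_index hT.measurable hprob
    (Y := fun k ω => ρbar ^ 2 * ‖x k ω - Z (x k ω)‖ ^ 2) (fun k _ => hxz k) hTind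
  simp only [hnorm]
  refine ⟨hdiff, hΦi k₀, hTi, ?_⟩
  rw [hTe]
  set S := C₁ + C₂ * α ^ 2 * (1 + Real.log K) with hS
  set Bd := ρbar / 2 * (2 * βt ^ 2 + 2 * β ^ 2 / (α * (ρbar - ρ))) with hBd
  set κ := ρ / 2 + ρ ^ 2 / (ρbar - ρ) with hκ
  have hSle : ∑ k ∈ Finset.range (K + 1), ∫ ω, ‖x k ω - x (k - 1) ω‖ ^ 2 ∂μ ≤ S := by
    rcases hC with ⟨Cφ, hCφ, rfl, rfl⟩ | ⟨Mr, hMr, hrM, rfl, rfl⟩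
    · exact h.sum_sq_step_le_of_boundedObjective hF_weak hρ hα ha hb' (by linarith) hCφ hK1
    · have hαρ : 0 < α * ρ := mul_pos hα hρ
      rw [hS, zero_add]
      exact h.sum_sq_step_le_of_indicatorPlus hα ha hb' (by linarith) hMr hrM hK1
  have hba : ∀ k, 1 ≤ k → ρbar / 2 * (2 * b k ^ 2 + 2 * (b k ^ 2 / a k) / (ρbar - ρ)) ≤ Bd := by
    intro k hk
    have h1 := pow_le_pow_left₀ (hb' k hk).1 (hb' k hk).2 2
    have h2 : b k ^ 2 / a k ≤ β ^ 2 / α := by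
      have hk' : (0 : ℝ) < k := by exact_mod_cast hk
      -- The decay of `b k ^ 2` matches that of `a k`, so their ratio is bounded uniformly in `k`.
      have h3 : b k ^ 2 ≤ β ^ 2 / √(k : ℝ) := by
        have h4 : b k ≤ β / (k : ℝ) ^ (1 / 4 : ℝ) := (hb k hk).le.trans (min_le_right _ _)
        refine (pow_le_pow_left₀ (hb' k hk).1 h4 2).trans_eq ?_
        rw [div_pow, ← Real.rpow_natCast ((k : ℝ) ^ (1 / 4 : ℝ)), ← Real.rpow_mul hk'.le,
          Real.sqrt_eq_rpow]
        norm_num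
      rw [div_le_iff₀ (hpos k hk), ha k hk]
      refine h3.trans_eq ?_
      field_simp
    calc ρbar / 2 * (2 * b k ^ 2 + 2 * (b k ^ 2 / a k) / (ρbar - ρ))
        ≤ ρbar / 2 * (2 * βt ^ 2 + 2 * (β ^ 2 / α) / (ρbar - ρ)) := by gcongr
      _ = Bd := by
          rw [hBd]
          field_simp
  have hsum := sum_descent_le (α := α) (ρ := ρ) (ρbar := ρbar) (M := M) (CF := CF) (κ := κ)
    (Bd := Bd) (S := S) (a := a) (p := p) (k₀ := k₀) (K := K) (τmax := τmax)
    (N := fun k => ∫ ω, ‖x k ω - Z (x k ω)‖ ^ 2 ∂μ)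
    (Pe := fun k => ∫ ω, moreauEnvelope (objective (expectedLoss P f) r) (1 / ρbar) (x k ω) ∂μ)
    (d := fun k => ∫ ω, ‖x k ω - x (k - 1) ω‖ ^ 2 ∂μ)
    (e := fun k => ∫ ω, expectedLoss P f (x k ω) ∂μ)
    (q := fun k j => ∫ ω, ‖x k ω - x (k - j) ω‖ ^ 2 ∂μ)
    hα ha hρb0 haρ hM (by positivity) (by positivity) hk₀ hK
    (fun j hj => by
      rw [← hτ.law 1 le_rfl j (Nat.lt_succ_iff.1 (Finset.mem_range.1 hj))]
      exact measureReal_nonneg)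
    hτ.sum_eq_one (by simp) (fun k => integral_nonneg fun ω => sq_nonneg _) hSle
    (fun k => by
      have := norm_integral_le_of_norm_le_const (μ := μ) (f := fun ω => expectedLoss P f (x k ω))
        (Filter.Eventually.of_forall fun ω => hCF _ (h.mem_dom k ω))
      simpa using this)
    (fun k j => integral_nonneg fun ω => sq_nonneg _) h.integral_sq_delay_le
    (fun k hk => by
      have hk1 : 1 ≤ k := hk₀.trans (Finset.mem_Icc.1 hk).1
      refine (h.expected_descent hF_weak hρ hρlt hρbar2 hφ_bdd hCF hmeas hZm hZ hZL hτ hk1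
        (haρ k hk1) (hb' k hk1).1).trans ?_
      have := mul_le_mul_of_nonneg_right (hba k hk1)
        (integral_nonneg fun ω => sq_nonneg _ : 0 ≤ ∫ ω, ‖x k ω - x (k - 1) ω‖ ^ 2 ∂μ)
      linarith)
  have hlast : optimalValue (objective (expectedLoss P f) r)
      ≤ ∫ ω, moreauEnvelope (objective (expectedLoss P f) r) (1 / ρbar) (x (K + 1) ω) ∂μ := by
    have h1 := integral_mono (integrable_const (μ := μ)
      (optimalValue (objective (expectedLoss P f) r))) (hΦi (K + 1)) fun ω => by
        have h2 := hopt _ ((hr.isProx_objective_iff _).1 (hZ (x (K + 1) ω))).1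
        have h3 : 0 ≤ 1 / (2 * (1 / ρbar)) * ‖Z (x (K + 1) ω) - x (K + 1) ω‖ ^ 2 := by positivity
        simp only [moreauEnvelope_eq hr (hZ (x (K + 1) ω))]
        linarith
    simpa using h1
  have hfirst : ∫ ω, (moreauEnvelope (objective (expectedLoss P f) r) (1 / ρbar) (x k₀ ω)
      - optimalValue (objective (expectedLoss P f) r)) ∂μ
      = (∫ ω, moreauEnvelope (objective (expectedLoss P f) r) (1 / ρbar) (x k₀ ω) ∂μ)
        - optimalValue (objective (expectedLoss P f) r) := by
    rw [integral_sub (hΦi k₀) (integrable_const _)]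
    simp
  rw [hfirst]
  have hD : 0 < √((K : ℝ) + 1) - √(k₀ : ℝ) := by
    refine sub_pos.2 (Real.sqrt_lt_sqrt (Nat.cast_nonneg _) ?_)
    exact_mod_cast Nat.lt_succ_of_le hK
  -- The factor `2` cancels the one in `2 * ρbar / ((ρbar - ρ) * A)`.
  have hAD : 2 * α * (√((K : ℝ) + 1) - √(k₀ : ℝ)) ≤ A := by
    have h1 := mul_le_mul_of_nonneg_left (sqrt_sub_sqrt_le_sum hk₀ hK) hα.le
    have h2 : α * ∑ k ∈ Finset.Icc k₀ K, 1 / √(k : ℝ) = A := by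
      rw [hA, Finset.mul_sum]
      refine Finset.sum_congr rfl fun k hk => ?_
      rw [ha k (hk₀.trans (Finset.mem_Icc.1 hk).1)]
      ring
    linarith
  have hleft : ∑ k ∈ Finset.Icc k₀ K, μ.real {ω | T ω = k}
      * ∫ ω, ρbar ^ 2 * ‖x k ω - Z (x k ω)‖ ^ 2 ∂μ
      = 2 * ρbar / ((ρbar - ρ) * A) * (ρbar * (ρbar - ρ) / 2
        * ∑ k ∈ Finset.Icc k₀ K, a k * ∫ ω, ‖x k ω - Z (x k ω)‖ ^ 2 ∂μ) := by
    rw [Finset.mul_sum, Finset.mul_sum]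
    refine Finset.sum_congr rfl fun k hk => ?_
    rw [hT.law k hk, ← hA, integral_const_mul]
    field_simp
  have hN0 : 0 ≤ ρbar * (ρbar - ρ) / 2
      * ∑ k ∈ Finset.Icc k₀ K, a k * ∫ ω, ‖x k ω - Z (x k ω)‖ ^ 2 ∂μ := by
    refine mul_nonneg (by positivity) (Finset.sum_nonneg fun k hk => ?_)
    exact mul_nonneg (hpos k (hk₀.trans (Finset.mem_Icc.1 hk).1)).le
      (integral_nonneg fun ω => sq_nonneg _)
  rw [hleft]
  have hcoef : 2 * ρbar / ((ρbar - ρ) * A)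
      ≤ ρbar / ((ρbar - ρ) * α * (√((K : ℝ) + 1) - √(k₀ : ℝ))) := by
    rw [div_le_div_iff₀ (by positivity) (by positivity)]
    have := mul_le_mul_of_nonneg_left hAD (by positivity : 0 ≤ ρbar * (ρbar - ρ))
    linarith
  refine mul_le_mul hcoef ?_ hN0 (by positivity)
  linarith
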